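/- Let $\mathcal E$ be a category with finite limits (and chosen finite products), and let $\mathcal V=(V_0,V_1,\otimes,\mathbb 1,\dots)$ be an internal monoidal category in $\mathcal E$: an internal category in $\mathcal E$ with object of objects $V_0$ and object of arrows $V_1$, an internal tensor functor, a unit $1\to V_0$, and internal natural isomorphisms (associator and unitors) satisfying the triangle and pentagon axioms. Equations "in context" below are equations between arrows $I\to V_1$, required for all generalized elements $x_i\colon I\to X$ with $I\in\mathcal E$. **The 2-category $\mathrm{Cat}_{\mathcal E}^{\mathcal V}$.** - An *internal $\mathcal V$-enriched category* is an object $X$ of $\mathcal E$ with arrows $\mathrm{Hom}\colon X\times X\to V_0$, $\mathrm{Comp}\colon X\times X\times X\to V_1$ and $\mathrm{Id}\colon X\to V_1$ such that in context $\mathrm{Comp}(x_0,x_1,x_2)\colon \mathrm{Hom}(x_1,x_2)\otimes\mathrm{Hom}(x_0,x_1)\to\mathrm{Hom}(x_0,x_2)$ and $\mathrm{Id}(x)\colon\mathbb 1\to\mathrm{Hom}(x,x)$, and such that composition is associative and unital in context. - An *internal $\mathcal V$-functor* $F\colon X\to Y$ consists of arrows $F_0\colon X\to Y$ and $F_1\colon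 X\times X\to V_1$ with $F_1(x_0,x_1)\colon\mathrm{Hom}(x_0,x_1)\to\mathrm{Hom}(F_0x_0,F_0x_1)$ in context, preserving identities and composition. - An *internal $\mathcal V$-natural transformation* $\alpha\colon F\Rightarrow G$ is an arrow $\alpha\colon X\to V_1$ with $\alpha(x)\colon\mathbb 1\to\mathrm{Hom}(F_0x,G_0x)$ in context such that the two arrows $\mathrm{Hom}(x_0,x_1)\to\mathrm{Hom}(F_0x_0,G_0x_1)$ obtained by composing $\alpha(x_1)$ with $F_1(x_0,x_1)$, and $G_1(x_0,x_1)$ with $\alpha(x_0)$, are equal. With the evident compositions these form a strict 2-category. **The 2-category $\mathrm{ICat}_{\mathcal E}^{\mathrm{Ext}\mathcal V}$.** The externalization $\mathrm{Ext}\,\mathcal V$ is the indexed monoidal category whose fibre $(\mathrm{Ext}\,\mathcal V)^I$ has as objects the arrows $I\to V_0$ and as morphisms $x\to y$ the arrows $I\to V_1$ with source $x$ and target $y$, with pointwise tensor; reindexing $r^*$ is precomposition with $r$. For an indexed monoidal category $\mathcal W$ over $\mathcal E$: - An *indexed $\mathcal W$-category* $\mathcal B$ consists of a $\mathcal W^I$-enriched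 category $\mathcal B^I$ for every $I$, a fully faithful $\mathcal W^I$-functor $r^*\colon (r^*)_\bullet\mathcal B^J\to\mathcal B^I$ for every $r\colon I\to J$, where $(r^*)_\bullet$ is change of base along $r^*\colon\mathcal W^J\to\mathcal W^I$, and enriched natural isomorphisms comparing the reindexings along composites and identities, subject to the associativity and unit axioms. - An *indexed $\mathcal W$-functor* $\mathcal F\colon\mathcal B\to\mathcal B'$ consists of $\mathcal W^I$-functors $\mathcal F^I\colon\mathcal B^I\to\mathcal B'^I$ and enriched natural isomorphisms $\mathcal F^I\circ r^*\cong r^*\circ(r^*)_\bullet\mathcal F^J$ compatible with the isomorphisms for composites and identities. - An *indexed $\mathcal W$-natural transformation* $\mathcal F\Rightarrow\mathcal G$ is a family of enriched natural transformations $\mathcal F^I\Rightarrow\mathcal G^I$ commuting with these isomorphisms. They form a strict 2-category $\mathrm{ICat}_{\mathcal E}^{\mathcal W}$. **Externalization.** For an internal $\mathcal V$-enriched category $X$, the fibre of $\mathrm{Ext}\,X$ over $I$ has as objects the arrows $x\colon I\to X$, hom-objects $\mathrm{Hom}(x_0,x_1)\colon I\to V_0$, and composition and identities given by $\mathrm{Comp}$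 and $\mathrm{Id}$ in context; reindexing along $r$ is $x\mapsto x\circ r$ on objects and the identity on hom-objects, and the comparison isomorphisms are identities. For an internal $\mathcal V$-functor $F$, the functor $(\mathrm{Ext}\,F)^I$ is $x\mapsto F_0\circ x$ on objects and $F_1(x_0,x_1)$ on hom-objects, with identity isomorphisms. For an internal $\mathcal V$-natural transformation $\alpha$, the component of $(\mathrm{Ext}\,\alpha)^I$ at $x$ is $\alpha(x)$. **Claim.** These assignments form a (strict) 2-functor $$\mathrm{Ext}\colon \mathrm{Cat}_{\mathcal E}^{\mathcal V}\longrightarrow\mathrm{ICat}_{\mathcal E}^{\mathrm{Ext}\,\mathcal V}.$$ This 2-functor is injective on internal $\mathcal V$-functors $X\to Y$, and for all internal $\mathcal V$-enriched categories $X$, $Y$ the functor $$\mathrm{Cat}_{\mathcal E}^{\mathcal V}(X,Y)\longrightarrow\mathrm{ICat}_{\mathcal E}^{\mathrm{Ext}\,\mathcal V}(\mathrm{Ext}\,X,\mathrm{Ext}\,Y)$$ is an equivalence of categories. That is, $\mathrm{Cat}_{\mathcal E}^{\mathcal V}$ is a full sub-2-category of $\mathrm{ICat}_{\mathcal E}^{\mathrm{Ext}\,\mathcal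 V}$, with inclusion $\mathrm{Ext}$. -/

import Mathlib

open CategoryTheory MonoidalCategory CartesianMonoidalCategory Limits

namespace InternalEnrichment

section Enriched

universe w w₁ w₂ w₃ v u v' u' v'' u''

/-- A category enriched over a (not necessarily symmetric) monoidal category `V`, with composition
`hom y z ⊗ hom x y ⟶ hom x z`. (The class `EnrichedCategory` of Mathlib uses the opposite order of
the tensor factors, and `EnrichedNatTrans` of Mathlib only asks for naturality with respect to
global elements, so neither is the notion needed here.) -/
structure VCat (V : Type u) [Category.{v} V] [MonoidalCategory V] where
  obj : Type w
  hom : obj → obj → V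
  idm (x : obj) : 𝟙_ V ⟶ hom x x
  comp (x y z : obj) : hom y z ⊗ hom x y ⟶ hom x z
  assoc (w x y z : obj) : comp x y z ▷ hom w x ≫ comp w x z =
    (α_ (hom y z) (hom x y) (hom w x)).hom ≫ hom y z ◁ comp w x y ≫ comp w y z
  id_comp (x y : obj) : idm y ▷ hom x y ≫ comp x y y = (λ_ (hom x y)).hom
  comp_id (x y : obj) : hom x y ◁ idm x ≫ comp x x y = (ρ_ (hom x y)).hom

variable {V : Type u} [Category.{v} V] [MonoidalCategory V]

/-- A morphism `x ⟶ y` of the underlying ordinary category of a `V`-category. -/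
@[ext]
structure VCat.Point (A : VCat.{w} V) (x y : A.obj) where
  el : 𝟙_ V ⟶ A.hom x y

namespace VCat

variable (A : VCat.{w} V)

/-- `hom x y ⟶ hom x z`, composition with a global element of `hom y z`. -/
def lc {y z : A.obj} (a : A.Point y z) (x : A.obj) : A.hom x y ⟶ A.hom x z :=
  (λ_ _).inv ≫ a.el ▷ A.hom x y ≫ A.comp x y z

/-- `hom y z ⟶ hom x z`, composition with a global element of `hom x y`. -/
def rc {x y : A.obj} (a : A.Point x y) (z : A.obj) : A.hom y z ⟶ A.hom x z :=
  (ρ_ _).inv ≫ A.hom y z ◁ a.el ≫ A.comp x y z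

/-- Composition in the underlying ordinary category. -/
def pcomp {x y z : A.obj} (a : A.Point x y) (b : A.Point y z) : A.Point x z :=
  ⟨(λ_ (𝟙_ V)).inv ≫ (b.el ⊗ₘ a.el) ≫ A.comp x y z⟩

/-- Identities of the underlying ordinary category. -/
def pid (x : A.obj) : A.Point x x := ⟨A.idm x⟩

variable {A}

theorem el_lc {x y z : A.obj} (a : A.Point x y) (b : A.Point y z) :
    a.el ≫ A.lc b x = (A.pcomp a b).el := by
  simp only [lc, pcomp, tensorHom_def', Category.assoc]
  rw [← leftUnitor_inv_naturality_assoc]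

theorem el_rc {x y z : A.obj} (a : A.Point x y) (b : A.Point y z) :
    b.el ≫ A.rc a z = (A.pcomp a b).el := by
  simp only [rc, pcomp, MonoidalCategory.tensorHom_def, Category.assoc]
  rw [unitors_inv_equal, ← rightUnitor_inv_naturality_assoc]

theorem lc_pid (x y : A.obj) : A.lc (A.pid y) x = 𝟙 _ := by
  simp [lc, pid, A.id_comp]

theorem rc_pid (x y : A.obj) : A.rc (A.pid x) y = 𝟙 _ := by
  simp [rc, pid, A.comp_id]

theorem lc_comp (x y z : A.obj) {t : A.obj} (b : A.Point z t) :
    A.comp x y z ≫ A.lc b x = A.lc b y ▷ A.hom x y ≫ A.comp x y t := by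
  simp only [lc, comp_whiskerRight, Category.assoc, A.assoc]
  rw [leftUnitor_inv_naturality_assoc, whisker_exchange_assoc]
  simp

theorem comp_rc (x y z : A.obj) {t : A.obj} (b : A.Point t x) :
    A.comp x y z ≫ A.rc b z = A.hom y z ◁ A.rc b y ≫ A.comp t y z := by
  simp only [rc, MonoidalCategory.whiskerLeft_comp, Category.assoc]
  have h := A.assoc t x y z
  rw [← Iso.inv_comp_eq] at h
  rw [← h, rightUnitor_inv_naturality_assoc, ← whisker_exchange_assoc]
  simp

theorem lc_pcomp {x y z : A.obj} (a : A.Point x y) (b : A.Point y z) (t : A.obj) :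
    A.lc (A.pcomp a b) t = A.lc a t ≫ A.lc b t := by
  rw [lc, ← el_lc, comp_whiskerRight, Category.assoc, ← lc_comp]
  simp only [lc, Category.assoc]

theorem rc_pcomp {x y z : A.obj} (a : A.Point x y) (b : A.Point y z) (t : A.obj) :
    A.rc (A.pcomp a b) t = A.rc b t ≫ A.rc a t := by
  rw [rc, ← el_rc, MonoidalCategory.whiskerLeft_comp, Category.assoc, ← comp_rc]
  simp only [rc, Category.assoc]

theorem rc_lc {x y z t : A.obj} (a : A.Point x y) (b : A.Point z t) :
    A.rc a z ≫ A.lc b x = A.lc b y ≫ A.rc a t := by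
  rw [rc, Category.assoc, Category.assoc, lc_comp, rc, rightUnitor_inv_naturality_assoc,
    ← whisker_exchange_assoc]

/-- The underlying ordinary category of a `V`-category. -/
instance : Category A.obj where
  Hom := A.Point
  id := A.pid
  comp := A.pcomp
  id_comp f := by
    ext; rw [← el_rc, rc_pid, Category.comp_id]
  comp_id f := by
    ext; rw [← el_lc, lc_pid, Category.comp_id]
  assoc f g h := by
    ext; rw [← el_lc, ← el_lc, ← el_lc, lc_pcomp, Category.assoc]

theorem hom_ext {x y : A.obj} {f g : x ⟶ y} (h : f.el = g.el) : f = g := Point.ext h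

theorem comp_el {x y z : A.obj} (f : x ⟶ y) (g : y ⟶ z) :
    (f ≫ g).el = f.el ≫ A.lc g x := (el_lc f g).symm

theorem comp_el' {x y z : A.obj} (f : x ⟶ y) (g : y ⟶ z) :
    (f ≫ g).el = g.el ≫ A.rc f z := (el_rc f g).symm

theorem lc_id (x y : A.obj) : A.lc (𝟙 y) x = 𝟙 _ := lc_pid x y

theorem rc_id (x y : A.obj) : A.rc (𝟙 x) y = 𝟙 _ := rc_pid x y

theorem lc_comp' {x y z : A.obj} (a : x ⟶ y) (b : y ⟶ z) (t : A.obj) :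
    A.lc (a ≫ b) t = A.lc a t ≫ A.lc b t := lc_pcomp a b t

theorem rc_comp' {x y z : A.obj} (a : x ⟶ y) (b : y ⟶ z) (t : A.obj) :
    A.rc (a ≫ b) t = A.rc b t ≫ A.rc a t := rc_pcomp a b t

end VCat

/-- A functor of `V`-categories. -/
structure VFunctor (A : VCat.{w} V) (B : VCat.{w₁} V) where
  obj : A.obj → B.obj
  map (x y : A.obj) : A.hom x y ⟶ B.hom (obj x) (obj y)
  map_id (x : A.obj) : A.idm x ≫ map x x = B.idm (obj x)
  map_comp (x y z : A.obj) :
    A.comp x y z ≫ map x z = (map y z ⊗ₘ map x y) ≫ B.comp (obj x) (obj y) (obj z)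

/-- A natural transformation of functors of `V`-categories: components `𝟙_ V ⟶ hom (F x) (G x)`
subject to naturality. -/
@[ext]
structure VNat {A : VCat.{w} V} {B : VCat.{w₁} V} (F G : VFunctor A B) where
  app (x : A.obj) : F.obj x ⟶ G.obj x
  naturality (x y : A.obj) :
    (λ_ (A.hom x y)).inv ≫ ((app y).el ⊗ₘ F.map x y) ≫ B.comp (F.obj x) (F.obj y) (G.obj y) =
      (ρ_ (A.hom x y)).inv ≫ (G.map x y ⊗ₘ (app x).el) ≫ B.comp (F.obj x) (G.obj x) (G.obj y)

namespace VNat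

variable {A : VCat.{w} V} {B : VCat.{w₁} V} {F G : VFunctor A B}

theorem lhs_eq {x y : A.obj} {t : B.obj} (b : F.obj y ⟶ t) :
    (λ_ (A.hom x y)).inv ≫ (b.el ⊗ₘ F.map x y) ≫ B.comp (F.obj x) (F.obj y) t =
      F.map x y ≫ B.lc b (F.obj x) := by
  rw [MonoidalCategory.tensorHom_def', Category.assoc, VCat.lc,
    ← leftUnitor_inv_naturality_assoc]

theorem rhs_eq {x y : A.obj} {t : B.obj} (b : t ⟶ G.obj x) :
    (ρ_ (A.hom x y)).inv ≫ (G.map x y ⊗ₘ b.el) ≫ B.comp t (G.obj x) (G.obj y) =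
      G.map x y ≫ B.rc b (G.obj y) := by
  rw [MonoidalCategory.tensorHom_def, Category.assoc, VCat.rc,
    ← rightUnitor_inv_naturality_assoc]

theorem nat (α : VNat F G) (x y : A.obj) :
    F.map x y ≫ B.lc (α.app y) _ = G.map x y ≫ B.rc (α.app x) _ := by
  rw [← lhs_eq, ← rhs_eq, α.naturality]

/-- Naturality expressed by composition with global elements. -/
def ofNat (app : ∀ x : A.obj, F.obj x ⟶ G.obj x)
    (h : ∀ x y, F.map x y ≫ B.lc (app y) _ = G.map x y ≫ B.rc (app x) _) : VNat F G where
  app := app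
  naturality x y := by rw [lhs_eq, rhs_eq, h]

end VNat

namespace VFunctor

variable {A : VCat.{w} V} {B : VCat.{w₁} V} {C : VCat.{w₂} V} {D : VCat.{w₃} V}

/-- Functors `A ⟶ B` and natural transformations form a category. -/
instance : Category (VFunctor A B) where
  Hom F G := VNat F G
  id F := VNat.ofNat (fun x => 𝟙 (F.obj x)) fun x y => by rw [VCat.lc_id, VCat.rc_id]
  comp α β := VNat.ofNat (fun x => α.app x ≫ β.app x) fun x y => by
    rw [VCat.lc_comp', VCat.rc_comp', ← Category.assoc, α.nat, Category.assoc, VCat.rc_lc,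
      ← Category.assoc, β.nat, Category.assoc]
  id_comp α := by apply VNat.ext; funext x; exact Category.id_comp _
  comp_id α := by apply VNat.ext; funext x; exact Category.comp_id _
  assoc α β γ := by apply VNat.ext; funext x; exact Category.assoc _ _ _

theorem nat_ext {F G : VFunctor A B} {α β : F ⟶ G} (h : ∀ x, α.app x = β.app x) : α = β :=
  VNat.ext (funext h)

@[simp]
theorem id_app (F : VFunctor A B) (x : A.obj) : VNat.app (𝟙 F) x = 𝟙 (F.obj x) := rfl

@[simp]
theorem comp_app {F G H : VFunctor A B} (α : F ⟶ G) (β : G ⟶ H) (x : A.obj) :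
    VNat.app (α ≫ β) x = α.app x ≫ β.app x := rfl

theorem hom_inv_app {F G : VFunctor A B} (α : F ≅ G) (x : A.obj) :
    α.hom.app x ≫ α.inv.app x = 𝟙 (F.obj x) := by
  rw [← comp_app, α.hom_inv_id, id_app]

theorem inv_hom_app {F G : VFunctor A B} (α : F ≅ G) (x : A.obj) :
    α.inv.app x ≫ α.hom.app x = 𝟙 (G.obj x) := by
  rw [← comp_app, α.inv_hom_id, id_app]

/-- The component of an isomorphism of functors, in the underlying ordinary category. -/
def isoApp {F G : VFunctor A B} (α : F ≅ G) (x : A.obj) : F.obj x ≅ G.obj x where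
  hom := α.hom.app x
  inv := α.inv.app x
  hom_inv_id := hom_inv_app α x
  inv_hom_id := inv_hom_app α x

/-- The action of a `V`-functor on the underlying ordinary categories. -/
def pmap (F : VFunctor A B) {x y : A.obj} (a : x ⟶ y) : F.obj x ⟶ F.obj y :=
  VCat.Point.mk (a.el ≫ F.map x y)

theorem lc_map (F : VFunctor A B) {y z : A.obj} (a : y ⟶ z) (x : A.obj) :
    A.lc a x ≫ F.map x z = F.map x y ≫ B.lc (F.pmap a) (F.obj x) := by
  rw [VCat.lc, Category.assoc, Category.assoc, F.map_comp, ← VNat.lhs_eq, pmap,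
    MonoidalCategory.tensorHom_def, MonoidalCategory.tensorHom_def]
  simp

theorem rc_map (F : VFunctor A B) {x y : A.obj} (a : x ⟶ y) (z : A.obj) :
    A.rc a z ≫ F.map x z = F.map y z ≫ B.rc (F.pmap a) (F.obj z) := by
  rw [VCat.rc, Category.assoc, Category.assoc, F.map_comp, ← VNat.rhs_eq, pmap,
    MonoidalCategory.tensorHom_def', MonoidalCategory.tensorHom_def']
  simp

@[simp]
theorem pmap_id (F : VFunctor A B) (x : A.obj) : F.pmap (𝟙 x) = 𝟙 (F.obj x) :=
  VCat.hom_ext (F.map_id x)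

@[simp]
theorem pmap_comp (F : VFunctor A B) {x y z : A.obj} (a : x ⟶ y) (b : y ⟶ z) :
    F.pmap (a ≫ b) = F.pmap a ≫ F.pmap b := by
  apply VCat.hom_ext
  simp only [VCat.comp_el, pmap, Category.assoc]
  rw [lc_map, pmap]

theorem pmap_nat {F G : VFunctor A B} (α : F ⟶ G) {x y : A.obj} (a : x ⟶ y) :
    F.pmap a ≫ α.app y = α.app x ≫ G.pmap a := by
  apply VCat.hom_ext
  rw [VCat.comp_el, VCat.comp_el', pmap, pmap, Category.assoc, Category.assoc, α.nat]

/-- The action of a `V`-functor on isomorphisms of the underlying ordinary categories. -/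
def pmapIso (F : VFunctor A B) {x y : A.obj} (a : x ≅ y) : F.obj x ≅ F.obj y where
  hom := F.pmap a.hom
  inv := F.pmap a.inv
  hom_inv_id := by rw [← pmap_comp, a.hom_inv_id, pmap_id]
  inv_hom_id := by rw [← pmap_comp, a.inv_hom_id, pmap_id]

/-- The identity functor. -/
def idf (A : VCat.{w} V) : VFunctor A A where
  obj x := x
  map x y := 𝟙 _
  map_id x := by simp
  map_comp x y z := by simp

theorem idf_pmap {x y : A.obj} (a : x ⟶ y) : (idf A).pmap a = a :=
  VCat.hom_ext (Category.comp_id _)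

/-- Composition of functors, in diagrammatic order. -/
def comp (F : VFunctor A B) (G : VFunctor B C) : VFunctor A C where
  obj x := G.obj (F.obj x)
  map x y := F.map x y ≫ G.map _ _
  map_id x := by rw [← Category.assoc, F.map_id, G.map_id]
  map_comp x y z := by
    rw [← Category.assoc, F.map_comp, Category.assoc, G.map_comp,
      ← tensorHom_comp_tensorHom, Category.assoc]

theorem comp_pmap (F : VFunctor A B) (G : VFunctor B C) {x y : A.obj} (a : x ⟶ y) :
    (F.comp G).pmap a = G.pmap (F.pmap a) :=
  VCat.hom_ext (Category.assoc _ _ _).symm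

theorem eq_of_map {F G : VFunctor A B} (h : F.obj = G.obj)
    (h' : ∀ x y, HEq (F.map x y) (G.map x y)) : F = G := by
  obtain ⟨o, m, _, _⟩ := F
  obtain ⟨o', m', _, _⟩ := G
  obtain rfl : o = o' := h
  obtain rfl : m = m' := funext fun x => funext fun y => eq_of_heq (h' x y)
  rfl

/-- The whiskering `F.comp G ⟶ F.comp G'` of `α : G ⟶ G'`. -/
def whiskerLeft (F : VFunctor A B) {G G' : VFunctor B C} (α : G ⟶ G') :
    F.comp G ⟶ F.comp G' :=
  VNat.ofNat (fun x => α.app (F.obj x)) fun x y => by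
    simp only [comp, Category.assoc, α.nat]

/-- The whiskering `F.comp G ⟶ F'.comp G` of `α : F ⟶ F'`. -/
def whiskerRight {F F' : VFunctor A B} (α : F ⟶ F') (G : VFunctor B C) :
    F.comp G ⟶ F'.comp G :=
  VNat.ofNat (fun x => G.pmap (α.app x)) fun x y => by
    simp only [comp, Category.assoc]
    rw [← lc_map, ← Category.assoc, α.nat, Category.assoc, rc_map]

/-- A natural transformation whose components are invertible is invertible. -/
def isoMk {F G : VFunctor A B} (app : ∀ x : A.obj, F.obj x ≅ G.obj x)
    (h : ∀ x y, F.map x y ≫ B.lc (app y).hom _ = G.map x y ≫ B.rc (app x).hom _) : F ≅ G where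
  hom := VNat.ofNat (fun x => (app x).hom) h
  inv := VNat.ofNat (fun x => (app x).inv) fun x y => by
    have := h x y
    have e1 : B.lc (app y).hom (F.obj x) ≫ B.lc (app y).inv (F.obj x) = 𝟙 _ := by
      rw [← VCat.lc_comp', Iso.hom_inv_id, VCat.lc_id]
    have e2 : B.rc (app x).hom (G.obj y) ≫ B.rc (app x).inv (G.obj y) = 𝟙 _ := by
      rw [← VCat.rc_comp', Iso.inv_hom_id, VCat.rc_id]
    calc G.map x y ≫ B.lc (app y).inv (G.obj x)
        = G.map x y ≫ (B.rc (app x).hom _ ≫ B.rc (app x).inv _) ≫ B.lc (app y).inv _ := by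
          rw [e2, Category.id_comp]
      _ = F.map x y ≫ (B.lc (app y).hom _ ≫ B.lc (app y).inv _) ≫ B.rc (app x).inv _ := by
          rw [Category.assoc, VCat.rc_lc, ← Category.assoc, ← this]
          simp only [Category.assoc]
      _ = F.map x y ≫ B.rc (app x).inv _ := by rw [e1, Category.id_comp]
  hom_inv_id := nat_ext fun x => (app x).hom_inv_id
  inv_hom_id := nat_ext fun x => (app x).inv_hom_id

end VFunctor

section BaseChange

variable {W : Type u'} [Category.{v'} W] [MonoidalCategory W]

open Functor.LaxMonoidal

/-- Change of base of a `V`-category along a lax monoidal functor `V ⥤ W`. -/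
def VCat.bc (Φ : V ⥤ W) [Φ.LaxMonoidal] (A : VCat.{w} V) : VCat.{w} W where
  obj := A.obj
  hom x y := Φ.obj (A.hom x y)
  idm x := ε Φ ≫ Φ.map (A.idm x)
  comp x y z := μ Φ _ _ ≫ Φ.map (A.comp x y z)
  assoc w x y z := by
    simp only [comp_whiskerRight, Category.assoc, μ_natural_left_assoc, ← Φ.map_comp, A.assoc,
      MonoidalCategory.whiskerLeft_comp, μ_natural_right_assoc]
    rw [Φ.map_comp, associativity_assoc]
  id_comp x y := by
    simp only [comp_whiskerRight, Category.assoc, μ_natural_left_assoc, ← Φ.map_comp, A.id_comp,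
      left_unitality]
  comp_id x y := by
    simp only [MonoidalCategory.whiskerLeft_comp, Category.assoc, μ_natural_right_assoc,
      ← Φ.map_comp, A.comp_id, right_unitality]

/-- The effect of a change of base on morphisms of underlying ordinary categories. -/
def VCat.bcPoint (Φ : V ⥤ W) [Φ.LaxMonoidal] {A : VCat.{w} V} {x y : A.obj} (a : x ⟶ y) :
    @Quiver.Hom (A.bc Φ).obj _ x y :=
  VCat.Point.mk (A := A.bc Φ) (ε Φ ≫ Φ.map a.el)

/-- Change of base of a `V`-functor along a lax monoidal functor. -/
def VFunctor.bc (Φ : V ⥤ W) [Φ.LaxMonoidal] {A : VCat.{w} V} {B : VCat.{w₁} V}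
    (F : VFunctor A B) : VFunctor (A.bc Φ) (B.bc Φ) where
  obj := F.obj
  map x y := Φ.map (F.map x y)
  map_id x := by
    have h := F.map_id x
    simp only [VCat.bc, Category.assoc, ← Φ.map_comp]
    rw [h]
  map_comp x y z := by
    have h := F.map_comp x y z
    simp only [VCat.bc, Category.assoc, ← Φ.map_comp]
    rw [h, Φ.map_comp, μ_natural_assoc]

/-- For lax monoidal functors `Φ`, `Ψ` and `Ξ` and a monoidal natural transformation
`Ξ ⟶ Φ ⋙ Ψ`, the functor from the change of base along `Ξ` to the iterated change of base that is
the identity on objects. -/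
def VFunctor.bcComp {U : Type u''} [Category.{v''} U] [MonoidalCategory U]
    (Φ : V ⥤ W) [Φ.LaxMonoidal] (Ψ : W ⥤ U) [Ψ.LaxMonoidal] (Ξ : V ⥤ U) [Ξ.LaxMonoidal]
    (τ : Ξ ⟶ Φ ⋙ Ψ) [NatTrans.IsMonoidal τ] (A : VCat.{w} V) :
    VFunctor (A.bc Ξ) ((A.bc Φ).bc Ψ) where
  obj x := x
  map x y := τ.app (A.hom x y)
  map_id x := by
    have h := NatTrans.IsMonoidal.unit (τ := τ)
    simp only [VCat.bc, Category.assoc, τ.naturality]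
    rw [← Category.assoc, h]
    simp
  map_comp x y z := by
    have h := NatTrans.IsMonoidal.tensor (τ := τ) (A.hom y z) (A.hom x y)
    simp only [VCat.bc, Category.assoc, τ.naturality]
    rw [← Category.assoc, h]
    simp

/-- For a lax monoidal functor `Ξ : V ⥤ V` and a monoidal natural transformation `Ξ ⟶ 𝟭 V`, the
functor from the change of base along `Ξ` that is the identity on objects. -/
def VFunctor.bcId (Ξ : V ⥤ V) [Ξ.LaxMonoidal] (τ : Ξ ⟶ 𝟭 V) [NatTrans.IsMonoidal τ]
    (A : VCat.{w} V) : VFunctor (A.bc Ξ) A where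
  obj x := x
  map x y := τ.app (A.hom x y)
  map_id x := by
    have h := NatTrans.IsMonoidal.unit (τ := τ)
    simp only [VCat.bc, Category.assoc, τ.naturality]
    rw [← Category.assoc, h]
    simp
  map_comp x y z := by
    have h := NatTrans.IsMonoidal.tensor (τ := τ) (A.hom y z) (A.hom x y)
    simp only [VCat.bc, Category.assoc, τ.naturality]
    rw [← Category.assoc, h]
    simp

theorem VCat.bcPoint_nat (Φ : V ⥤ W) [Φ.LaxMonoidal] {A : VCat.{w} V} {B : VCat.{w₁} V}
    (F : VFunctor A B) {x y : A.obj} (a : x ⟶ y) :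
    (F.bc Φ).pmap (VCat.bcPoint Φ a) = VCat.bcPoint Φ (F.pmap a) := by
  apply VCat.hom_ext
  simp only [VFunctor.pmap, VCat.bcPoint, VFunctor.bc, Φ.map_comp]
  exact Category.assoc _ _ _

theorem VCat.bc_lc (Φ : V ⥤ W) [Φ.LaxMonoidal] {A : VCat.{w} V} {y z : A.obj} (a : y ⟶ z)
    (x : A.obj) : (A.bc Φ).lc (VCat.bcPoint Φ a) x = Φ.map (A.lc a x) := by
  simp only [VCat.lc, VCat.bcPoint, VCat.bc, comp_whiskerRight, Category.assoc,
    μ_natural_left_assoc, Φ.map_comp, left_unitality_inv_assoc]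

theorem VCat.bcPoint_comp (Φ : V ⥤ W) [Φ.LaxMonoidal] {A : VCat.{w} V} {x y z : A.obj}
    (a : x ⟶ y) (b : y ⟶ z) :
    VCat.bcPoint Φ (a ≫ b) =
      @CategoryStruct.comp (A.bc Φ).obj _ x y z (VCat.bcPoint Φ a) (VCat.bcPoint Φ b) := by
  apply VCat.hom_ext
  refine Eq.trans ?_ (VCat.comp_el (A := A.bc Φ) (VCat.bcPoint Φ a) (VCat.bcPoint Φ b)).symm
  rw [VCat.bc_lc]
  simp only [VCat.bcPoint, VCat.comp_el, Φ.map_comp]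
  exact (Category.assoc _ _ _).symm

/-- The action of a functor `A.bc Φ ⟶ B` on a morphism of the underlying category of `A`. -/
def VFunctor.bcMap {Φ : V ⥤ W} [Φ.LaxMonoidal] {A : VCat.{w} V} {B : VCat.{w₁} W}
    (F : VFunctor (A.bc Φ) B) {x y : A.obj} (a : x ⟶ y) : F.obj x ⟶ F.obj y :=
  F.pmap (VCat.bcPoint Φ a)

theorem VFunctor.bcMap_id {Φ : V ⥤ W} [Φ.LaxMonoidal] {A : VCat.{w} V} {B : VCat.{w₁} W}
    (F : VFunctor (A.bc Φ) B) (x : A.obj) : F.bcMap (𝟙 x) = 𝟙 (F.obj x) :=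
  F.pmap_id x

theorem VFunctor.bcMap_comp {Φ : V ⥤ W} [Φ.LaxMonoidal] {A : VCat.{w} V} {B : VCat.{w₁} W}
    (F : VFunctor (A.bc Φ) B) {x y z : A.obj} (a : x ⟶ y) (b : y ⟶ z) :
    F.bcMap (a ≫ b) = F.bcMap a ≫ F.bcMap b :=
  (congrArg F.pmap (VCat.bcPoint_comp Φ a b)).trans (F.pmap_comp _ _)

end BaseChange

end Enriched

section Indexed

universe w w₁ v u v' u'

/-- An indexed monoidal category over `E`: a pseudofunctor from the opposite of `E` to monoidal
categories, strong monoidal functors and monoidal natural transformations. The comparison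
isomorphism of a composable pair `f`, `g` is given for every `h` with a proof of `f ≫ g = h`,
which saves transporting along equalities of morphisms of `E`. -/
structure IndexedMonCat (E : Type u) [Category.{v} E] where
  fib : E → Type u'
  [cat (X : E) : Category.{v'} (fib X)]
  [mon (X : E) : MonoidalCategory (fib X)]
  map {X Y : E} (f : X ⟶ Y) : fib Y ⥤ fib X
  [mapMon {X Y : E} (f : X ⟶ Y) : (map f).Monoidal]
  mapComp {X Y Z : E} (f : X ⟶ Y) (g : Y ⟶ Z) (h : X ⟶ Z) (w : f ≫ g = h) :
    map h ≅ map g ⋙ map f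
  [mapComp_mon {X Y Z : E} (f : X ⟶ Y) (g : Y ⟶ Z) (h : X ⟶ Z) (w : f ≫ g = h) :
    NatTrans.IsMonoidal (mapComp f g h w).hom]
  mapId (X : E) : map (𝟙 X) ≅ 𝟭 (fib X)
  [mapId_mon (X : E) : NatTrans.IsMonoidal (mapId X).hom]
  map_assoc {X Y Z T : E} (f : X ⟶ Y) (g : Y ⟶ Z) (h : Z ⟶ T) (fg : X ⟶ Z) (gh : Y ⟶ T)
    (fgh : X ⟶ T) (w₁ : f ≫ g = fg) (w₂ : g ≫ h = gh) (w₃ : f ≫ gh = fgh) (w₄ : fg ≫ h = fgh)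
    (a : fib T) :
    (mapComp f gh fgh w₃).hom.app a ≫ (map f).map ((mapComp g h gh w₂).hom.app a) =
      (mapComp fg h fgh w₄).hom.app a ≫ (mapComp f g fg w₁).hom.app ((map h).obj a)
  map_id_left {X Y : E} (f : X ⟶ Y) (a : fib Y) :
    (mapComp (𝟙 X) f f (Category.id_comp f)).hom.app a ≫ (mapId X).hom.app ((map f).obj a) = 𝟙 _
  map_id_right {X Y : E} (f : X ⟶ Y) (a : fib Y) :
    (mapComp f (𝟙 Y) f (Category.comp_id f)).hom.app a ≫ (map f).map ((mapId Y).hom.app a) = 𝟙 _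

attribute [instance] IndexedMonCat.cat IndexedMonCat.mon IndexedMonCat.mapMon
  IndexedMonCat.mapComp_mon IndexedMonCat.mapId_mon

variable {E : Type u} [Category.{v} E]

/-- The data of an indexed `W`-category: fibres, fully faithful reindexing functors, and natural
isomorphisms comparing reindexing along composites and identities. -/
structure IndexedCatData (W : IndexedMonCat.{v, u, v', u'} E) where
  fib (X : E) : VCat.{w} (W.fib X)
  re {X Y : E} (f : X ⟶ Y) : VFunctor ((fib Y).bc (W.map f)) (fib X)
  re_fullyFaithful {X Y : E} (f : X ⟶ Y) (x y : (fib Y).obj) : IsIso ((re f).map x y)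
  compIso {X Y Z : E} (f : X ⟶ Y) (g : Y ⟶ Z) (h : X ⟶ Z) (w : f ≫ g = h) :
    re h ≅ (VFunctor.bcComp (W.map g) (W.map f) (W.map h) (W.mapComp f g h w).hom (fib Z)).comp
      (((re g).bc (W.map f)).comp (re f))
  idIso (X : E) : re (𝟙 X) ≅ VFunctor.bcId (W.map (𝟙 X)) (W.mapId X).hom (fib X)

variable {W : IndexedMonCat.{v, u, v', u'} E}

namespace IndexedCatData

variable (B : IndexedCatData.{w} W)

/-- Reindexing of objects. -/
def reObj {X Y : E} (f : X ⟶ Y) (b : (B.fib Y).obj) : (B.fib X).obj := (B.re f).obj b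

/-- Reindexing of morphisms of the underlying ordinary categories of the fibres. -/
def reMap {X Y : E} (f : X ⟶ Y) {b b' : (B.fib Y).obj} (a : b ⟶ b') :
    B.reObj f b ⟶ B.reObj f b' := (B.re f).bcMap a

/-- The components of the comparison isomorphisms for composites. -/
def compC {X Y Z : E} (f : X ⟶ Y) (g : Y ⟶ Z) (h : X ⟶ Z) (w : f ≫ g = h) (b : (B.fib Z).obj) :
    B.reObj h b ≅ B.reObj f (B.reObj g b) := VFunctor.isoApp (B.compIso f g h w) b

/-- The components of the comparison isomorphisms for identities. -/
def idC (X : E) (b : (B.fib X).obj) : B.reObj (𝟙 X) b ≅ b := VFunctor.isoApp (B.idIso X) b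

theorem reMap_id {X Y : E} (f : X ⟶ Y) (b : (B.fib Y).obj) : B.reMap f (𝟙 b) = 𝟙 _ :=
  VFunctor.bcMap_id _ _

theorem reMap_comp {X Y : E} (f : X ⟶ Y) {b b' b'' : (B.fib Y).obj} (a : b ⟶ b') (a' : b' ⟶ b'') :
    B.reMap f (a ≫ a') = B.reMap f a ≫ B.reMap f a' :=
  VFunctor.bcMap_comp _ _ _

end IndexedCatData

/-- An indexed `W`-category: the associativity and unit axioms are equalities of natural
transformations, stated on components. -/
structure IndexedCat (W : IndexedMonCat.{v, u, v', u'} E) extends IndexedCatData.{w} W where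
  comp_assoc {X Y Z T : E} (f : X ⟶ Y) (g : Y ⟶ Z) (h : Z ⟶ T) (fg : X ⟶ Z) (gh : Y ⟶ T)
    (fgh : X ⟶ T) (w₁ : f ≫ g = fg) (w₂ : g ≫ h = gh) (w₃ : f ≫ gh = fgh) (w₄ : fg ≫ h = fgh)
    (b : (fib T).obj) :
    (toIndexedCatData.compC f gh fgh w₃ b).hom ≫
        toIndexedCatData.reMap f (toIndexedCatData.compC g h gh w₂ b).hom =
      (toIndexedCatData.compC fg h fgh w₄ b).hom ≫
        (toIndexedCatData.compC f g fg w₁ (toIndexedCatData.reObj h b)).hom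
  id_left {X Y : E} (f : X ⟶ Y) (b : (fib Y).obj) :
    (toIndexedCatData.compC (𝟙 X) f f (Category.id_comp f) b).hom ≫
      (toIndexedCatData.idC X (toIndexedCatData.reObj f b)).hom = 𝟙 _
  id_right {X Y : E} (f : X ⟶ Y) (b : (fib Y).obj) :
    (toIndexedCatData.compC f (𝟙 Y) f (Category.comp_id f) b).hom ≫
      toIndexedCatData.reMap f (toIndexedCatData.idC Y b).hom = 𝟙 _

/-- The data of an indexed `W`-functor: functors of the fibres which commute with reindexing up to
natural isomorphism. -/
structure IndexedFunctorData (B : IndexedCat.{w} W) (B' : IndexedCat.{w₁} W) where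
  app (X : E) : VFunctor (B.fib X) (B'.fib X)
  iso {X Y : E} (f : X ⟶ Y) :
    (B.re f).comp (app X) ≅ ((app Y).bc (W.map f)).comp (B'.re f)

/-- The components of the isomorphisms of an indexed `W`-functor. -/
def IndexedFunctorData.isoC {B : IndexedCat.{w} W} {B' : IndexedCat.{w₁} W}
    (F : IndexedFunctorData B B') {X Y : E} (f : X ⟶ Y) (b : (B.fib Y).obj) :
    (F.app X).obj (B.reObj f b) ≅ B'.reObj f ((F.app Y).obj b) :=
  VFunctor.isoApp (F.iso f) b

/-- An indexed `W`-functor. -/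
structure IndexedFunctor (B : IndexedCat.{w} W) (B' : IndexedCat.{w₁} W) extends
    IndexedFunctorData B B' where
  iso_comp {X Y Z : E} (f : X ⟶ Y) (g : Y ⟶ Z) (h : X ⟶ Z) (w : f ≫ g = h) (b : (B.fib Z).obj) :
    (app X).pmap (B.compC f g h w b).hom ≫ (toIndexedFunctorData.isoC f (B.reObj g b)).hom ≫
        B'.reMap f (toIndexedFunctorData.isoC g b).hom =
      (toIndexedFunctorData.isoC h b).hom ≫ (B'.compC f g h w ((app Z).obj b)).hom
  iso_id (X : E) (b : (B.fib X).obj) :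
    (toIndexedFunctorData.isoC (𝟙 X) b).hom ≫ (B'.idC X ((app X).obj b)).hom =
      (app X).pmap (B.idC X b).hom

/-- An indexed `W`-natural transformation. -/
@[ext]
structure IndexedNat {B : IndexedCat.{w} W} {B' : IndexedCat.{w₁} W}
    (F G : IndexedFunctor B B') where
  app (X : E) : F.app X ⟶ G.app X
  naturality {X Y : E} (f : X ⟶ Y) (b : (B.fib Y).obj) :
    (app X).app (B.reObj f b) ≫ (G.isoC f b).hom =
      (F.isoC f b).hom ≫ B'.reMap f ((app Y).app b)

theorem nat_glue {C : Type u} [Category.{v} C] {x₀ x₁ x₂ x₃ x₄ x₅ x₆ x₇ x₈ x₉ x₁₀ x₁₁ x₁₂ : C}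
    {a : x₀ ⟶ x₁} {F : x₁ ⟶ x₂} {lφ : x₂ ⟶ x₃} {ΦF : x₀ ⟶ x₄} {r : x₄ ⟶ x₅} {rφ : x₅ ⟶ x₃}
    {G₁ : x₂ ⟶ x₆} {G₂ : x₃ ⟶ x₇} {G₃ : x₅ ⟶ x₈} {lGφ : x₆ ⟶ x₇} {rGφ : x₈ ⟶ x₇}
    {lγ : x₇ ⟶ x₉} {lγ' : x₈ ⟶ x₁₀} {rGφ' : x₁₀ ⟶ x₉} {ΦG : x₄ ⟶ x₁₁} {r' : x₁₁ ⟶ x₁₂}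
    {rγ : x₁₂ ⟶ x₁₀}
    (hF : (a ≫ F) ≫ lφ = (ΦF ≫ r) ≫ rφ) (hG : (r ≫ G₃) ≫ lγ' = (ΦG ≫ r') ≫ rγ)
    (hl : lφ ≫ G₂ = G₁ ≫ lGφ) (hr : rφ ≫ G₂ = G₃ ≫ rGφ) (hc : rGφ ≫ lγ = lγ' ≫ rGφ') :
    (a ≫ F ≫ G₁) ≫ lGφ ≫ lγ = ((ΦF ≫ ΦG) ≫ r') ≫ rγ ≫ rGφ' := by
  simp only [Category.assoc] at *
  rw [← reassoc_of% hl, reassoc_of% hF, reassoc_of% hr, hc, reassoc_of% hG]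

theorem comp_glue {C : Type u} [Category.{v} C] {x₀ x₁ x₂ x₃ x₄ x₅ x₆ x₇ x₈ : C}
    {p : x₀ ⟶ x₁} {q : x₁ ⟶ x₂} {m : x₂ ⟶ x₃} {h : x₀ ⟶ x₄} {c : x₄ ⟶ x₃} {γ : x₃ ⟶ x₅}
    {t : x₅ ⟶ x₆} {γh : x₄ ⟶ x₇} {c' : x₇ ⟶ x₆} {g : x₂ ⟶ x₈} {s : x₈ ⟶ x₅}
    (hF : p ≫ q ≫ m = h ≫ c) (hG : c ≫ γ ≫ t = γh ≫ c') (hn : m ≫ γ = g ≫ s) :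
    p ≫ (q ≫ g) ≫ (s ≫ t) = (h ≫ γh) ≫ c' := by
  simp only [Category.assoc]
  rw [← hG, ← reassoc_of% hF, reassoc_of% hn]

namespace IndexedFunctor

variable {B B' B'' B₃ : IndexedCat.{w} W}

theorem isoC_nat (F : IndexedFunctor B B') {X Y : E} (f : X ⟶ Y) {b b' : (B.fib Y).obj}
    (a : b ⟶ b') :
    (F.app X).pmap (B.reMap f a) ≫ (F.isoC f b').hom =
      (F.isoC f b).hom ≫ B'.reMap f ((F.app Y).pmap a) := by
  have h := VFunctor.pmap_nat (F.iso f).hom (VCat.bcPoint (W.map f) a)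
  have e₁ := VFunctor.comp_pmap (B.re f) (F.app X) (VCat.bcPoint (W.map f) a)
  have e₂ := VFunctor.comp_pmap ((F.app Y).bc (W.map f)) (B'.re f) (VCat.bcPoint (W.map f) a)
  have e₃ := congrArg (B'.re f).pmap (VCat.bcPoint_nat (W.map f) (F.app Y) a)
  exact ((congrArg (· ≫ (F.isoC f b').hom) e₁).symm.trans h).trans
    (congrArg ((F.isoC f b).hom ≫ ·) (e₂.trans e₃))

/-- Indexed functors and indexed natural transformations form a category. -/
instance : Category (IndexedFunctor B B') where
  Hom F G := IndexedNat F G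
  id F :=
    { app := fun X => 𝟙 (F.app X)
      naturality := fun f b => by
        rw [VFunctor.id_app, VFunctor.id_app, Category.id_comp, B'.reMap_id, Category.comp_id] }
  comp α β :=
    { app := fun X => α.app X ≫ β.app X
      naturality := fun f b => by
        rw [VFunctor.comp_app, VFunctor.comp_app, Category.assoc, β.naturality, ← Category.assoc,
          α.naturality, Category.assoc, B'.reMap_comp] }
  id_comp α := by apply IndexedNat.ext; funext X; exact Category.id_comp _
  comp_id α := by apply IndexedNat.ext; funext X; exact Category.comp_id _
  assoc α β γ := by apply IndexedNat.ext; funext X; exact Category.assoc _ _ _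

/-- The identity indexed functor. -/
def idf (B : IndexedCat.{w} W) : IndexedFunctor B B where
  app X := VFunctor.idf (B.fib X)
  iso f := VFunctor.isoMk (fun b => Iso.refl _) fun x y => by
    refine (congrArg₂ (· ≫ ·) rfl (VCat.lc_id _ _)).trans
      (Eq.trans ?_ (congrArg₂ (· ≫ ·) rfl (VCat.rc_id _ _)).symm)
    refine (Category.comp_id _).trans (Eq.trans ?_ (Category.comp_id _).symm)
    exact (Category.comp_id _).trans ((congrArg (· ≫ (B.re f).map x y)
      ((W.map f).map_id ((B.fib _).hom x y))).trans (Category.id_comp _)).symm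
  iso_comp f g h w b := by
    refine (congrArg₂ (· ≫ ·) (VFunctor.idf_pmap _) ((Category.id_comp _).trans (B.reMap_id f _))).trans ?_
    exact (Category.comp_id _).trans (Category.id_comp _).symm
  iso_id X b := (Category.id_comp _).trans (VFunctor.idf_pmap _).symm

/-- Composition of indexed functors, in diagrammatic order. -/
def comp (F : IndexedFunctor B B') (G : IndexedFunctor B' B'') : IndexedFunctor B B'' where
  app X := (F.app X).comp (G.app X)
  iso {X Y} f :=
    VFunctor.isoMk
      (fun b => (G.app X).pmapIso (F.isoC f b) ≪≫ G.isoC f ((F.app Y).obj b)) fun x y => by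
    have hF : ((B.re f).map x y ≫ (F.app X).map _ _) ≫ (B'.fib X).lc (F.isoC f y).hom _ =
      ((W.map f).map ((F.app Y).map x y) ≫ (B'.re f).map _ _) ≫
        (B'.fib X).rc (F.isoC f x).hom _ := (F.iso f).hom.nat x y
    have hG : ((B'.re f).map _ _ ≫ (G.app X).map _ _) ≫
        (B''.fib X).lc (G.isoC f ((F.app Y).obj y)).hom _ =
      ((W.map f).map ((G.app Y).map _ _) ≫ (B''.re f).map _ _) ≫
        (B''.fib X).rc (G.isoC f ((F.app Y).obj x)).hom _ :=
      (G.iso f).hom.nat ((F.app Y).obj x) ((F.app Y).obj y)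
    change ((B.re f).map x y ≫ (F.app X).map _ _ ≫ (G.app X).map _ _) ≫
      (B''.fib X).lc ((G.app X).pmap (F.isoC f y).hom ≫ (G.isoC f ((F.app Y).obj y)).hom) _ =
      ((W.map f).map ((F.app Y).map x y ≫ (G.app Y).map _ _) ≫ (B''.re f).map _ _) ≫
      (B''.fib X).rc ((G.app X).pmap (F.isoC f x).hom ≫ (G.isoC f ((F.app Y).obj x)).hom) _
    rw [VCat.lc_comp', VCat.rc_comp', Functor.map_comp]
    exact nat_glue hF hG ((G.app X).lc_map _ _) ((G.app X).rc_map _ _) (VCat.rc_lc _ _)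
  iso_comp {X Y Z} f g h w b := by
    have hF := congrArg (G.app X).pmap (F.iso_comp f g h w b)
    have hG := G.iso_comp f g h w ((F.app Z).obj b)
    have hn := G.isoC_nat f (F.isoC g b).hom
    rw [VFunctor.pmap_comp, VFunctor.pmap_comp, VFunctor.pmap_comp] at hF
    exact (congrArg₂ (· ≫ ·) (VFunctor.comp_pmap (F.app X) (G.app X) (B.compC f g h w b).hom)
      (congrArg (((G.app X).pmap (F.isoC f (B.reObj g b)).hom ≫
        (G.isoC f ((F.app Y).obj (B.reObj g b))).hom) ≫ ·)
        (B''.reMap_comp f ((G.app Y).pmap (F.isoC g b).hom)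
          (G.isoC g ((F.app Z).obj b)).hom))).trans (comp_glue hF hG hn)
  iso_id X b := by
    change ((G.app X).pmap (F.isoC (𝟙 X) b).hom ≫ (G.isoC (𝟙 X) ((F.app X).obj b)).hom) ≫
        (B''.idC X ((G.app X).obj ((F.app X).obj b))).hom =
      ((F.app X).comp (G.app X)).pmap (B.idC X b).hom
    rw [VFunctor.comp_pmap, ← F.iso_id, VFunctor.pmap_comp, ← G.iso_id, Category.assoc]

/-- Whiskering of an indexed natural transformation. -/
def whiskerLeft (F : IndexedFunctor B B') {G G' : IndexedFunctor B' B''} (α : G ⟶ G') :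
    F.comp G ⟶ F.comp G' :=
  IndexedNat.mk (F := F.comp G) (G := F.comp G')
    (fun X => VFunctor.whiskerLeft (F.app X) (α.app X)) fun {X Y} f b => by
    change (α.app X).app ((F.app X).obj (B.reObj f b)) ≫
        (G'.app X).pmap (F.isoC f b).hom ≫ (G'.isoC f ((F.app Y).obj b)).hom =
      ((G.app X).pmap (F.isoC f b).hom ≫ (G.isoC f ((F.app Y).obj b)).hom) ≫
        B''.reMap f ((α.app Y).app ((F.app Y).obj b))
    rw [Category.assoc, ← α.naturality, ← Category.assoc, ← Category.assoc, VFunctor.pmap_nat]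

/-- Whiskering of an indexed natural transformation. -/
def whiskerRight {F F' : IndexedFunctor B B'} (α : F ⟶ F') (G : IndexedFunctor B' B'') :
    F.comp G ⟶ F'.comp G :=
  IndexedNat.mk (F := F.comp G) (G := F'.comp G)
    (fun X => VFunctor.whiskerRight (α.app X) (G.app X)) fun {X Y} f b => by
    change (G.app X).pmap ((α.app X).app (B.reObj f b)) ≫
        (G.app X).pmap (F'.isoC f b).hom ≫ (G.isoC f ((F'.app Y).obj b)).hom =
      ((G.app X).pmap (F.isoC f b).hom ≫ (G.isoC f ((F.app Y).obj b)).hom) ≫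
        B''.reMap f ((G.app Y).pmap ((α.app Y).app b))
    have hn := G.isoC_nat f ((α.app Y).app b)
    have ha := congrArg (G.app X).pmap (α.naturality f b)
    rw [VFunctor.pmap_comp, VFunctor.pmap_comp] at ha
    rw [Category.assoc, ← hn, reassoc_of% ha]

theorem nat_ext {F G : IndexedFunctor B B'} {α β : F ⟶ G}
    (h : ∀ X b, (α.app X).app b = (β.app X).app b) : α = β :=
  IndexedNat.ext (funext fun X => VFunctor.nat_ext (h X))

theorem eq_of_isoC {F G : IndexedFunctor B B'} (h : ∀ X, F.app X = G.app X)
    (h' : ∀ {X Y : E} (f : X ⟶ Y) (b : (B.fib Y).obj), HEq (F.isoC f b).hom (G.isoC f b).hom) :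
    F = G := by
  obtain ⟨⟨a, i⟩, _, _⟩ := F
  obtain ⟨⟨a', i'⟩, _, _⟩ := G
  obtain rfl : a = a' := funext h
  have : @i = @i' := by
    funext X Y f
    apply Iso.ext
    apply VFunctor.nat_ext
    intro b
    exact eq_of_heq (h' f b)
  subst this
  rfl

theorem eqToHom_app {F G : IndexedFunctor B B'} (h : F = G) (X : E) (b : (B.fib X).obj)
    (e : (F.app X).obj b ⟶ (G.app X).obj b) (he : HEq e (𝟙 ((F.app X).obj b))) :
    (IndexedNat.app (eqToHom h) X).app b = e := by
  subst h; exact (eq_of_heq he).symm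

theorem conj_id {C : Type u} [Category.{v} C] {x y : C} {p : x ⟶ x} {q : y ⟶ y} {a a' : x ⟶ y}
    (ha : a' = a) (hp : p = 𝟙 x) (hq : q = 𝟙 y) : a' = p ≫ a ≫ q := by
  subst ha hp hq; simp

theorem idf_comp (F : IndexedFunctor B B') : (idf B).comp F = F := by
  apply eq_of_isoC
  · intro X
    refine VFunctor.eq_of_map rfl fun x y => ?_
    exact heq_of_eq (Category.id_comp _)
  · intro X Y f b
    exact heq_of_eq ((congrArg (· ≫ (F.isoC f b).hom) ((F.app X).pmap_id _)).trans
      (Category.id_comp _))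

theorem comp_idf (F : IndexedFunctor B B') : F.comp (idf B') = F := by
  apply eq_of_isoC
  · intro X
    refine VFunctor.eq_of_map rfl fun x y => ?_
    exact heq_of_eq (Category.comp_id _)
  · intro X Y f b
    exact heq_of_eq ((Category.comp_id _).trans (VFunctor.idf_pmap _))

theorem assoc (F : IndexedFunctor B B') (G : IndexedFunctor B' B'') (H : IndexedFunctor B'' B₃) :
    (F.comp G).comp H = F.comp (G.comp H) := by
  apply eq_of_isoC
  · intro X
    refine VFunctor.eq_of_map rfl fun x y => ?_
    exact heq_of_eq (Category.assoc _ _ _)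
  · intro X Y f b
    refine heq_of_eq ?_
    change (H.app X).pmap ((G.app X).pmap (F.isoC f b).hom ≫ (G.isoC f ((F.app Y).obj b)).hom) ≫
      (H.isoC f _).hom = ((G.app X).comp (H.app X)).pmap (F.isoC f b).hom ≫
        (H.app X).pmap (G.isoC f ((F.app Y).obj b)).hom ≫ (H.isoC f _).hom
    refine (congrArg (· ≫ (H.isoC f _).hom) ((H.app X).pmap_comp _ _)).trans
      ((Category.assoc _ _ _).trans ?_)
    exact congrArg (· ≫ (H.app X).pmap (G.isoC f ((F.app Y).obj b)).hom ≫ (H.isoC f _).hom)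
      (VFunctor.comp_pmap _ _ _).symm

end IndexedFunctor

/-- The 2-category of indexed `W`-categories. -/
instance : Bicategory (IndexedCat.{w} W) where
  Hom B B' := IndexedFunctor B B'
  id B := IndexedFunctor.idf B
  comp F G := F.comp G
  whiskerLeft F _ _ α := IndexedFunctor.whiskerLeft F α
  whiskerRight α G := IndexedFunctor.whiskerRight α G
  associator F G H := eqToIso (IndexedFunctor.assoc F G H)
  leftUnitor F := eqToIso (IndexedFunctor.idf_comp F)
  rightUnitor F := eqToIso (IndexedFunctor.comp_idf F)
  whiskerLeft_id F G := rfl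
  whiskerLeft_comp F _ _ _ α β := rfl
  id_whiskerLeft {_ _ F G} α := IndexedFunctor.nat_ext fun X b => IndexedFunctor.conj_id rfl
    (IndexedFunctor.eqToHom_app (IndexedFunctor.idf_comp F) X b (𝟙 _) HEq.rfl)
    (IndexedFunctor.eqToHom_app (IndexedFunctor.idf_comp G).symm X b (𝟙 _) HEq.rfl)
  comp_whiskerLeft {_ _ _ _} F G {H H'} α := IndexedFunctor.nat_ext fun X b => IndexedFunctor.conj_id rfl
    (IndexedFunctor.eqToHom_app (IndexedFunctor.assoc F G H) X b (𝟙 _) HEq.rfl)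
    (IndexedFunctor.eqToHom_app (IndexedFunctor.assoc F G H').symm X b (𝟙 _) HEq.rfl)
  id_whiskerRight F G := IndexedFunctor.nat_ext fun X b => (G.app X).pmap_id _
  comp_whiskerRight α β G := IndexedFunctor.nat_ext fun X b => (G.app X).pmap_comp _ _
  whiskerRight_id {_ _ F G} α := IndexedFunctor.nat_ext fun X b => IndexedFunctor.conj_id
    (VFunctor.idf_pmap _)
    (IndexedFunctor.eqToHom_app (IndexedFunctor.comp_idf F) X b (𝟙 _) HEq.rfl)
    (IndexedFunctor.eqToHom_app (IndexedFunctor.comp_idf G).symm X b (𝟙 _) HEq.rfl)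
  whiskerRight_comp {_ _ _ _ F F'} α G H := IndexedFunctor.nat_ext fun X b =>
    IndexedFunctor.conj_id (VFunctor.comp_pmap (G.app X) (H.app X) _)
    (IndexedFunctor.eqToHom_app (IndexedFunctor.assoc F G H).symm X b (𝟙 _) HEq.rfl)
    (IndexedFunctor.eqToHom_app (IndexedFunctor.assoc F' G H) X b (𝟙 _) HEq.rfl)
  whisker_assoc {_ _ _ _} F {G G'} α H := IndexedFunctor.nat_ext fun X b => IndexedFunctor.conj_id rfl
    (IndexedFunctor.eqToHom_app (IndexedFunctor.assoc F G H) X b (𝟙 _) HEq.rfl)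
    (IndexedFunctor.eqToHom_app (IndexedFunctor.assoc F G' H).symm X b (𝟙 _) HEq.rfl)
  whisker_exchange α β := IndexedFunctor.nat_ext fun X b =>
    (VFunctor.pmap_nat (IndexedNat.app β X) ((IndexedNat.app α X).app b)).symm
  pentagon F G H K := by
    refine IndexedFunctor.nat_ext fun X b => ?_
    have h₁ := IndexedFunctor.eqToHom_app (IndexedFunctor.assoc F G H) X b (𝟙 _) HEq.rfl
    have h₂ := IndexedFunctor.eqToHom_app (IndexedFunctor.assoc F (G.comp H) K) X b (𝟙 _) HEq.rfl
    have h₃ := IndexedFunctor.eqToHom_app (IndexedFunctor.assoc G H K) X ((F.app X).obj b) (𝟙 _)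
      HEq.rfl
    have h₄ := IndexedFunctor.eqToHom_app (IndexedFunctor.assoc (F.comp G) H K) X b (𝟙 _) HEq.rfl
    have h₅ := IndexedFunctor.eqToHom_app (IndexedFunctor.assoc F G (H.comp K)) X b (𝟙 _) HEq.rfl
    exact (congrArg₂ (· ≫ ·) ((congrArg (K.app X).pmap h₁).trans ((K.app X).pmap_id _))
      (congrArg₂ (· ≫ ·) h₂ h₃)).trans
        ((Category.id_comp _).trans (congrArg₂ (· ≫ ·) h₄ h₅).symm)
  triangle F G := by
    refine IndexedFunctor.nat_ext fun X b => ?_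
    have h₁ := IndexedFunctor.eqToHom_app
      (IndexedFunctor.assoc F (IndexedFunctor.idf _) G) X b (𝟙 _) HEq.rfl
    have h₂ := IndexedFunctor.eqToHom_app (IndexedFunctor.idf_comp G) X ((F.app X).obj b) (𝟙 _)
      HEq.rfl
    have h₃ := IndexedFunctor.eqToHom_app (IndexedFunctor.comp_idf F) X b (𝟙 _) HEq.rfl
    exact (congrArg₂ (· ≫ ·) h₁ h₂).trans ((Category.id_comp _).trans
      ((congrArg (G.app X).pmap h₃).trans ((G.app X).pmap_id _)).symm)

/-- Composition of indexed functors is strictly associative and unital. -/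
instance : Bicategory.Strict (IndexedCat.{w} W) where
  id_comp {B B'} F := IndexedFunctor.idf_comp (B := B) (B' := B') F
  comp_id {B B'} F := IndexedFunctor.comp_idf (B := B) (B' := B') F
  assoc {B B' B'' B₃} F G H := IndexedFunctor.assoc (B := B) (B' := B') (B'' := B'') (B₃ := B₃) F G H
  leftUnitor_eqToIso _ := rfl
  rightUnitor_eqToIso _ := rfl
  associator_eqToIso _ _ _ := rfl

end Indexed

noncomputable section Internal

universe w v u

variable {E : Type u} [Category.{v} E] [HasFiniteLimits E]

/-- An internal category in `E`. Composition is defined on the pullback of source and target, whose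
generalized elements are the pairs `(g, f)` with `src g = tgt f`. Axioms in a context are stated
for generalized elements `I ⟶ ar`, here and in the definitions below. -/
structure IntCat (E : Type u) [Category.{v} E] [HasFiniteLimits E] where
  ob : E
  ar : E
  idm : ob ⟶ ar
  src : ar ⟶ ob
  tgt : ar ⟶ ob
  comp : pullback src tgt ⟶ ar
  id_src : idm ≫ src = 𝟙 ob
  id_tgt : idm ≫ tgt = 𝟙 ob
  comp_src : comp ≫ src = pullback.snd src tgt ≫ src
  comp_tgt : comp ≫ tgt = pullback.fst src tgt ≫ tgt
  id_comp {I : E} (f : I ⟶ ar) :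
    pullback.lift (f ≫ tgt ≫ idm) f (by simp [id_src]) ≫ comp = f
  comp_id {I : E} (f : I ⟶ ar) :
    pullback.lift f (f ≫ src ≫ idm) (by simp [id_tgt]) ≫ comp = f
  assoc {I : E} (h g f : I ⟶ ar) (hg : h ≫ src = g ≫ tgt) (gf : g ≫ src = f ≫ tgt) :
    pullback.lift (pullback.lift h g hg ≫ comp) f
      (by rw [Category.assoc, comp_src, pullback.lift_snd_assoc, gf]) ≫ comp =
      pullback.lift h (pullback.lift g f gf ≫ comp)
        (by rw [Category.assoc, comp_tgt, pullback.lift_fst_assoc, hg]) ≫ comp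

/-- A family of objects of an internal category, indexed by an object `I` of `E`. -/
@[ext]
structure IntCat.Fam (A : IntCat E) (I : E) : Type v where
  el : I ⟶ A.ob

/-- A family of arrows `f : x ⟶ y` in an internal category, in context `I`. -/
@[ext]
structure IntCat.FamHom (A : IntCat E) {I : E} (x y : A.Fam I) : Type v where
  ar : I ⟶ A.ar
  ar_src : ar ≫ A.src = x.el
  ar_tgt : ar ≫ A.tgt = y.el

namespace IntCat

variable {A : IntCat E} {I J : E}

/-- The category of `I`-indexed families of objects and arrows of an internal category, that is,
the fibre over `I` of its externalization. -/
instance : Category (A.Fam I) where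
  Hom x y := A.FamHom x y
  id x := ⟨x.el ≫ A.idm, by simp [A.id_src], by simp [A.id_tgt]⟩
  comp f g := ⟨pullback.lift g.ar f.ar (by rw [g.ar_src, f.ar_tgt]) ≫ A.comp,
    by rw [Category.assoc, A.comp_src, pullback.lift_snd_assoc, f.ar_src], by rw [Category.assoc, A.comp_tgt, pullback.lift_fst_assoc, g.ar_tgt]⟩
  id_comp f := by
    ext
    have h := A.comp_id f.ar
    simp only [← Category.assoc, f.ar_src] at h
    exact h
  comp_id f := by
    ext
    have h := A.id_comp f.ar
    simp only [← Category.assoc, f.ar_tgt] at h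
    exact h
  assoc f g h := by
    ext
    exact (A.assoc h.ar g.ar f.ar (by rw [h.ar_src, g.ar_tgt]) (by rw [g.ar_src, f.ar_tgt])).symm

theorem fam_hom_ext {x y : A.Fam I} {f g : x ⟶ y} (h : f.ar = g.ar) : f = g := FamHom.ext h

theorem id_ar (x : A.Fam I) : FamHom.ar (𝟙 x) = x.el ≫ A.idm := rfl

theorem comp_ar {x y z : A.Fam I} (f : x ⟶ y) (g : y ⟶ z) :
    FamHom.ar (f ≫ g) =
      pullback.lift g.ar f.ar (by rw [g.ar_src, f.ar_tgt]) ≫ A.comp := rfl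

/-- Composites of families have equal arrows if the factors do. -/
theorem comp_ar_congr {x y z x' y' z' : A.Fam I} {f : x ⟶ y} {g : y ⟶ z} {f' : x' ⟶ y'}
    {g' : y' ⟶ z'} (hf : f.ar = f'.ar) (hg : g.ar = g'.ar) :
    FamHom.ar (f ≫ g) = FamHom.ar (f' ≫ g') := by
  simp only [comp_ar, hf, hg]

/-- The identity family, between equal families of objects. -/
def famIso {x y : A.Fam I} (h : x.el = y.el) : x ≅ y := eqToIso (Fam.ext h)

theorem famIso_hom_ar {x y : A.Fam I} (h : x.el = y.el) : (famIso h).hom.ar = x.el ≫ A.idm := by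
  obtain rfl : x = y := Fam.ext h
  rfl

theorem famIso_comp_ar {x y z : A.Fam I} (h : x.el = y.el) (f : y ⟶ z) :
    FamHom.ar ((famIso h).hom ≫ f) = f.ar := by
  obtain rfl : x = y := Fam.ext h
  exact congrArg FamHom.ar (Category.id_comp f)

theorem comp_famIso_ar {x y z : A.Fam I} (h : y.el = z.el) (f : x ⟶ y) :
    FamHom.ar (f ≫ (famIso h).hom) = f.ar := by
  obtain rfl : y = z := Fam.ext h
  exact congrArg FamHom.ar (Category.comp_id f)

/-- Reindexing of families. -/
def reindex (A : IntCat E) (r : I ⟶ J) : A.Fam J ⥤ A.Fam I where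
  obj x := ⟨r ≫ x.el⟩
  map f := ⟨r ≫ f.ar, by rw [Category.assoc, f.ar_src], by rw [Category.assoc, f.ar_tgt]⟩
  map_id x := by
    apply fam_hom_ext
    simp [id_ar]
  map_comp f g := by
    apply fam_hom_ext
    simp only [comp_ar, ← Category.assoc]
    congr 1
    apply pullback.hom_ext
    · rw [Category.assoc, pullback.lift_fst, pullback.lift_fst]
    · rw [Category.assoc, pullback.lift_snd, pullback.lift_snd]

theorem reindex_map_ar (r : I ⟶ J) {x y : A.Fam J} (f : x ⟶ y) :
    ((A.reindex r).map f).ar = r ≫ f.ar := rfl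

end IntCat

/-- The data of an internal monoidal category: an internal category with a tensor product of
objects and arrows, a unit object, and families of arrows which are the associator, the unitors
and their inverses. -/
structure IntMonData (E : Type u) [Category.{v} E] [CartesianMonoidalCategory E]
    [HasFiniteLimits E] extends IntCat E where
  tensorOb : ob ⊗ ob ⟶ ob
  tensorAr : ar ⊗ ar ⟶ ar
  tensor_src : tensorAr ≫ src = (src ⊗ₘ src) ≫ tensorOb
  tensor_tgt : tensorAr ≫ tgt = (tgt ⊗ₘ tgt) ≫ tensorOb
  unit : 𝟙_ E ⟶ ob
  assocHom : ob ⊗ ob ⊗ ob ⟶ ar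
  assocInv : ob ⊗ ob ⊗ ob ⟶ ar
  leftHom : ob ⟶ ar
  leftInv : ob ⟶ ar
  rightHom : ob ⟶ ar
  rightInv : ob ⟶ ar
  assocHom_src {I : E} (a b c : I ⟶ ob) : lift a (lift b c) ≫ assocHom ≫ src =
    lift (lift a b ≫ tensorOb) c ≫ tensorOb
  assocHom_tgt {I : E} (a b c : I ⟶ ob) : lift a (lift b c) ≫ assocHom ≫ tgt =
    lift a (lift b c ≫ tensorOb) ≫ tensorOb
  assocInv_src {I : E} (a b c : I ⟶ ob) : lift a (lift b c) ≫ assocInv ≫ src =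
    lift a (lift b c ≫ tensorOb) ≫ tensorOb
  assocInv_tgt {I : E} (a b c : I ⟶ ob) : lift a (lift b c) ≫ assocInv ≫ tgt =
    lift (lift a b ≫ tensorOb) c ≫ tensorOb
  leftHom_src {I : E} (a : I ⟶ ob) : a ≫ leftHom ≫ src = lift (toUnit I ≫ unit) a ≫ tensorOb
  leftHom_tgt {I : E} (a : I ⟶ ob) : a ≫ leftHom ≫ tgt = a
  leftInv_src {I : E} (a : I ⟶ ob) : a ≫ leftInv ≫ src = a
  leftInv_tgt {I : E} (a : I ⟶ ob) : a ≫ leftInv ≫ tgt = lift (toUnit I ≫ unit) a ≫ tensorOb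
  rightHom_src {I : E} (a : I ⟶ ob) : a ≫ rightHom ≫ src = lift a (toUnit I ≫ unit) ≫ tensorOb
  rightHom_tgt {I : E} (a : I ⟶ ob) : a ≫ rightHom ≫ tgt = a
  rightInv_src {I : E} (a : I ⟶ ob) : a ≫ rightInv ≫ src = a
  rightInv_tgt {I : E} (a : I ⟶ ob) : a ≫ rightInv ≫ tgt = lift a (toUnit I ≫ unit) ≫ tensorOb

namespace IntMonData

open IntCat

variable [CartesianMonoidalCategory E] (V : IntMonData E) {I J : E}

/-- The tensor product of families of objects. -/
def tens (x y : V.Fam I) : V.Fam I := ⟨lift x.el y.el ≫ V.tensorOb⟩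

/-- The tensor product of families of arrows. -/
def tensHom {x x' y y' : V.Fam I} (f : x ⟶ x') (g : y ⟶ y') : V.tens x y ⟶ V.tens x' y' :=
  FamHom.mk (lift f.ar g.ar ≫ V.tensorAr)
    (by simp [V.tensor_src, f.ar_src, g.ar_src, tens])
    (by simp [V.tensor_tgt, f.ar_tgt, g.ar_tgt, tens])

/-- The constant family on the unit. -/
def unitFam (I : E) : V.Fam I := ⟨toUnit I ≫ V.unit⟩

def aHom (x y z : V.Fam I) : V.tens (V.tens x y) z ⟶ V.tens x (V.tens y z) :=
  FamHom.mk (lift x.el (lift y.el z.el) ≫ V.assocHom)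
    (by simp [V.assocHom_src, tens]) (by simp [V.assocHom_tgt, tens])

def aInv (x y z : V.Fam I) : V.tens x (V.tens y z) ⟶ V.tens (V.tens x y) z :=
  FamHom.mk (lift x.el (lift y.el z.el) ≫ V.assocInv)
    (by simp [V.assocInv_src, tens]) (by simp [V.assocInv_tgt, tens])

def lHom (x : V.Fam I) : V.tens (V.unitFam I) x ⟶ x :=
  FamHom.mk (x.el ≫ V.leftHom)
    (by simp [V.leftHom_src, tens, unitFam]) (by simp [V.leftHom_tgt])

def lInv (x : V.Fam I) : x ⟶ V.tens (V.unitFam I) x :=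
  FamHom.mk (x.el ≫ V.leftInv)
    (by simp [V.leftInv_src]) (by simp [V.leftInv_tgt, tens, unitFam])

def rHom (x : V.Fam I) : V.tens x (V.unitFam I) ⟶ x :=
  FamHom.mk (x.el ≫ V.rightHom)
    (by simp [V.rightHom_src, tens, unitFam]) (by simp [V.rightHom_tgt])

def rInv (x : V.Fam I) : x ⟶ V.tens x (V.unitFam I) :=
  FamHom.mk (x.el ≫ V.rightInv)
    (by simp [V.rightInv_src]) (by simp [V.rightInv_tgt, tens, unitFam])

end IntMonData

/-- An internal monoidal category: the tensor product is an internal functor, the associator and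
the unitors are natural isomorphisms, and the triangle and pentagon axioms hold. -/
structure IntMonCat (E : Type u) [Category.{v} E] [CartesianMonoidalCategory E]
    [HasFiniteLimits E] extends IntMonData E where
  tensor_id {I : E} (x y : toIntCat.Fam I) :
    toIntMonData.tensHom (𝟙 x) (𝟙 y) = 𝟙 (toIntMonData.tens x y)
  tensor_comp {I : E} {x₁ x₂ x₃ y₁ y₂ y₃ : toIntCat.Fam I} (f₁ : x₁ ⟶ x₂) (f₂ : x₂ ⟶ x₃)
    (g₁ : y₁ ⟶ y₂) (g₂ : y₂ ⟶ y₃) :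
    toIntMonData.tensHom (f₁ ≫ f₂) (g₁ ≫ g₂) =
      toIntMonData.tensHom f₁ g₁ ≫ toIntMonData.tensHom f₂ g₂
  assoc_hom_inv {I : E} (x y z : toIntCat.Fam I) :
    toIntMonData.aHom x y z ≫ toIntMonData.aInv x y z = 𝟙 _
  assoc_inv_hom {I : E} (x y z : toIntCat.Fam I) :
    toIntMonData.aInv x y z ≫ toIntMonData.aHom x y z = 𝟙 _
  left_hom_inv {I : E} (x : toIntCat.Fam I) : toIntMonData.lHom x ≫ toIntMonData.lInv x = 𝟙 _
  left_inv_hom {I : E} (x : toIntCat.Fam I) : toIntMonData.lInv x ≫ toIntMonData.lHom x = 𝟙 _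
  right_hom_inv {I : E} (x : toIntCat.Fam I) : toIntMonData.rHom x ≫ toIntMonData.rInv x = 𝟙 _
  right_inv_hom {I : E} (x : toIntCat.Fam I) : toIntMonData.rInv x ≫ toIntMonData.rHom x = 𝟙 _
  assoc_naturality {I : E} {x x' y y' z z' : toIntCat.Fam I} (f : x ⟶ x') (g : y ⟶ y')
    (h : z ⟶ z') :
    toIntMonData.tensHom (toIntMonData.tensHom f g) h ≫ toIntMonData.aHom x' y' z' =
      toIntMonData.aHom x y z ≫ toIntMonData.tensHom f (toIntMonData.tensHom g h)
  left_naturality {I : E} {x x' : toIntCat.Fam I} (f : x ⟶ x') :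
    toIntMonData.tensHom (𝟙 (toIntMonData.unitFam I)) f ≫ toIntMonData.lHom x' =
      toIntMonData.lHom x ≫ f
  right_naturality {I : E} {x x' : toIntCat.Fam I} (f : x ⟶ x') :
    toIntMonData.tensHom f (𝟙 (toIntMonData.unitFam I)) ≫ toIntMonData.rHom x' =
      toIntMonData.rHom x ≫ f
  triangle {I : E} (x y : toIntCat.Fam I) :
    toIntMonData.aHom x (toIntMonData.unitFam I) y ≫
        toIntMonData.tensHom (𝟙 x) (toIntMonData.lHom y) =
      toIntMonData.tensHom (toIntMonData.rHom x) (𝟙 y)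
  pentagon {I : E} (w x y z : toIntCat.Fam I) :
    toIntMonData.tensHom (toIntMonData.aHom w x y) (𝟙 z) ≫
        toIntMonData.aHom w (toIntMonData.tens x y) z ≫
          toIntMonData.tensHom (𝟙 w) (toIntMonData.aHom x y z) =
      toIntMonData.aHom (toIntMonData.tens w x) y z ≫
        toIntMonData.aHom w x (toIntMonData.tens y z)

namespace IntMonCat

open IntCat

variable [CartesianMonoidalCategory E] (V : IntMonCat E) {I J : E}

/-- The monoidal structure on the fibres of the externalization. -/
instance : MonoidalCategoryStruct (V.Fam I) where
  tensorObj x y := V.tens x y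
  whiskerLeft x _ _ f := V.tensHom (𝟙 x) f
  whiskerRight f y := V.tensHom f (𝟙 y)
  tensorHom f g := V.tensHom f g
  tensorUnit := V.unitFam I
  associator x y z := ⟨V.aHom x y z, V.aInv x y z, V.assoc_hom_inv x y z, V.assoc_inv_hom x y z⟩
  leftUnitor x := ⟨V.lHom x, V.lInv x, V.left_hom_inv x, V.left_inv_hom x⟩
  rightUnitor x := ⟨V.rHom x, V.rInv x, V.right_hom_inv x, V.right_inv_hom x⟩

instance : MonoidalCategory (V.Fam I) := MonoidalCategory.ofTensorHom
  (id_tensorHom_id := fun x y => V.tensor_id x y)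
  (id_tensorHom := fun _ _ _ _ => rfl)
  (tensorHom_id := fun _ _ => rfl)
  (tensorHom_comp_tensorHom := fun f₁ f₂ g₁ g₂ => (V.tensor_comp f₁ g₁ f₂ g₂).symm)
  (associator_naturality := fun f g h => V.assoc_naturality f g h)
  (leftUnitor_naturality := fun f => V.left_naturality f)
  (rightUnitor_naturality := fun f => V.right_naturality f)
  (pentagon := fun w x y z => V.pentagon w x y z)
  (triangle := fun x y => V.triangle x y)

theorem tensorHom_ar {x x' y y' : V.Fam I} (f : x ⟶ x') (g : y ⟶ y') :
    FamHom.ar (f ⊗ₘ g) = lift f.ar g.ar ≫ V.tensorAr := rfl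

theorem whiskerRight_ar {x x' : V.Fam I} (f : x ⟶ x') (y : V.Fam I) :
    FamHom.ar (f ▷ y) = lift f.ar (y.el ≫ V.idm) ≫ V.tensorAr := rfl

theorem whiskerLeft_ar (x : V.Fam I) {y y' : V.Fam I} (g : y ⟶ y') :
    FamHom.ar (x ◁ g) = lift (x.el ≫ V.idm) g.ar ≫ V.tensorAr := rfl

theorem tensor_el (x y : V.Fam I) : (x ⊗ y).el = lift x.el y.el ≫ V.tensorOb := rfl

theorem unit_el : (𝟙_ (V.Fam I)).el = toUnit I ≫ V.unit := rfl

theorem associator_ar (x y z : V.Fam I) :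
    FamHom.ar (α_ x y z).hom = lift x.el (lift y.el z.el) ≫ V.assocHom := rfl

theorem leftUnitor_ar (x : V.Fam I) : FamHom.ar (λ_ x).hom = x.el ≫ V.leftHom := rfl

theorem rightUnitor_ar (x : V.Fam I) : FamHom.ar (ρ_ x).hom = x.el ≫ V.rightHom := rfl

theorem leftUnitor_inv_ar (x : V.Fam I) : FamHom.ar (λ_ x).inv = x.el ≫ V.leftInv := rfl

/-- A morphism of families which is an identity up to an equality of families of objects. -/
def IsFamId {x y : V.Fam I} (f : x ⟶ y) : Prop := f.ar = x.el ≫ V.idm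

namespace IsFamId

variable {V}

theorem el_eq {x y : V.Fam I} {f : x ⟶ y} (h : V.IsFamId f) : x.el = y.el := by
  rw [← f.ar_tgt, h, Category.assoc, V.id_tgt, Category.comp_id]

theorem eq {x y : V.Fam I} {f g : x ⟶ y} (hf : V.IsFamId f) (hg : V.IsFamId g) : f = g :=
  fam_hom_ext (hf.trans hg.symm)

theorem of_id (x : V.Fam I) : V.IsFamId (𝟙 x) := rfl

theorem of_famIso {x y : V.Fam I} (h : x.el = y.el) : V.IsFamId (famIso h).hom := famIso_hom_ar h

theorem comp_ar {x y z : V.Fam I} {f : x ⟶ y} (hf : V.IsFamId f) (g : y ⟶ z) :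
    FamHom.ar (f ≫ g) = g.ar := by
  obtain rfl : x = y := Fam.ext hf.el_eq
  obtain rfl : f = 𝟙 x := hf.eq (of_id x)
  rw [Category.id_comp]

theorem ar_comp {x y z : V.Fam I} {g : y ⟶ z} (hg : V.IsFamId g) (f : x ⟶ y) :
    FamHom.ar (f ≫ g) = f.ar := by
  obtain rfl : y = z := Fam.ext hg.el_eq
  obtain rfl : g = 𝟙 y := hg.eq (of_id y)
  rw [Category.comp_id]

theorem comp {x y z : V.Fam I} {f : x ⟶ y} {g : y ⟶ z} (hf : V.IsFamId f) (hg : V.IsFamId g) :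
    V.IsFamId (f ≫ g) := (hg.ar_comp f).trans hf

theorem tensor {x x' y y' : V.Fam I} {f : x ⟶ x'} {g : y ⟶ y'} (hf : V.IsFamId f)
    (hg : V.IsFamId g) : V.IsFamId (f ⊗ₘ g) := by
  obtain rfl : x = x' := Fam.ext hf.el_eq
  obtain rfl : f = 𝟙 x := hf.eq (of_id x)
  obtain rfl : y = y' := Fam.ext hg.el_eq
  obtain rfl : g = 𝟙 y := hg.eq (of_id y)
  rw [id_tensorHom_id]
  exact of_id _

theorem whiskerRight {x x' : V.Fam I} {f : x ⟶ x'} (hf : V.IsFamId f) (y : V.Fam I) :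
    V.IsFamId (f ▷ y) := hf.tensor (of_id y)

theorem whiskerLeft {y y' : V.Fam I} {g : y ⟶ y'} (hg : V.IsFamId g) (x : V.Fam I) :
    V.IsFamId (x ◁ g) := (of_id x).tensor hg

theorem reindex {x y : V.Fam J} {f : x ⟶ y} (hf : V.IsFamId f) (r : I ⟶ J) :
    V.IsFamId ((V.toIntCat.reindex r).map f) := by
  rw [IsFamId, reindex_map_ar, hf, ← Category.assoc]
  rfl

end IsFamId

theorem reindex_el (r : I ⟶ J) (x : V.Fam J) : ((V.toIntCat.reindex r).obj x).el = r ≫ x.el := rfl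

theorem reindex_tensor_el (r : I ⟶ J) (x y : V.Fam J) :
    ((V.toIntCat.reindex r).obj x ⊗ (V.toIntCat.reindex r).obj y : V.Fam I).el =
      ((V.toIntCat.reindex r).obj (x ⊗ y)).el := by
  rw [tensor_el, reindex_el, reindex_el, reindex_el, tensor_el, comp_lift_assoc]

theorem reindex_unit_el (r : I ⟶ J) :
    (𝟙_ (V.Fam I)).el = ((V.toIntCat.reindex r).obj (𝟙_ (V.Fam J))).el := by
  rw [reindex_el, unit_el, unit_el, comp_toUnit_assoc]

/-- Reindexing of families is a strong monoidal functor, with identities as structure maps. -/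
def reindexMonoidal (r : I ⟶ J) : (V.toIntCat.reindex r : V.Fam J ⥤ V.Fam I).CoreMonoidal where
  εIso := famIso (V.reindex_unit_el r)
  μIso x y := famIso (V.reindex_tensor_el r x y)
  μIso_hom_natural_left {x x'} f y := by
    apply fam_hom_ext
    rw [comp_famIso_ar, famIso_comp_ar, reindex_map_ar, whiskerRight_ar, whiskerRight_ar,
      reindex_map_ar, comp_lift_assoc, reindex_el, Category.assoc]
  μIso_hom_natural_right {y y'} x f := by
    apply fam_hom_ext
    rw [comp_famIso_ar, famIso_comp_ar, reindex_map_ar, whiskerLeft_ar, whiskerLeft_ar,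
      reindex_map_ar, comp_lift_assoc, reindex_el, Category.assoc]
  associativity x y z := by
    apply fam_hom_ext
    rw [((IsFamId.of_famIso _).whiskerRight _).comp_ar, famIso_comp_ar,
      (((IsFamId.of_famIso _).whiskerLeft _).comp (IsFamId.of_famIso _)).ar_comp, reindex_map_ar,
      associator_ar, associator_ar, comp_lift_assoc, comp_lift]
    rfl
  left_unitality x := by
    apply fam_hom_ext
    rw [((IsFamId.of_famIso _).whiskerRight _).comp_ar, famIso_comp_ar, reindex_map_ar,
      leftUnitor_ar, leftUnitor_ar, ← Category.assoc]
    rfl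
  right_unitality x := by
    apply fam_hom_ext
    rw [((IsFamId.of_famIso _).whiskerLeft _).comp_ar, famIso_comp_ar, reindex_map_ar,
      rightUnitor_ar, rightUnitor_ar, ← Category.assoc]
    rfl

instance (r : I ⟶ J) : (V.toIntCat.reindex r : V.Fam J ⥤ V.Fam I).Monoidal :=
  (V.reindexMonoidal r).toMonoidal

open Functor.LaxMonoidal

theorem ε_reindex (r : I ⟶ J) :
    V.IsFamId (ε (V.toIntCat.reindex r : V.Fam J ⥤ V.Fam I)) :=
  IsFamId.of_famIso (V.reindex_unit_el r)

theorem μ_reindex (r : I ⟶ J) (x y : V.Fam J) :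
    V.IsFamId (μ (V.toIntCat.reindex r : V.Fam J ⥤ V.Fam I) x y) :=
  IsFamId.of_famIso (V.reindex_tensor_el r x y)

theorem reindexComp_el {K : E} (r : I ⟶ J) (s : J ⟶ K) (t : I ⟶ K) (w : r ≫ s = t)
    (x : V.Fam K) : ((V.toIntCat.reindex t).obj x).el =
      ((V.toIntCat.reindex s ⋙ V.toIntCat.reindex r).obj x).el := by
  rw [Functor.comp_obj, reindex_el, reindex_el, reindex_el, ← w, Category.assoc]

/-- Reindexing along a composite is the composite of the reindexing functors. -/
def reindexComp {K : E} (r : I ⟶ J) (s : J ⟶ K) (t : I ⟶ K) (w : r ≫ s = t) :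
    (V.toIntCat.reindex t : V.Fam K ⥤ V.Fam I) ≅
      (V.toIntCat.reindex s : V.Fam K ⥤ V.Fam J) ⋙ V.toIntCat.reindex r :=
  NatIso.ofComponents (fun x => famIso (V.reindexComp_el r s t w x)) fun f => by
    apply fam_hom_ext
    rw [comp_famIso_ar, famIso_comp_ar, Functor.comp_map, reindex_map_ar, reindex_map_ar,
      reindex_map_ar, ← w, Category.assoc]

theorem reindexId_el (I : E) (x : V.Fam I) :
    ((V.toIntCat.reindex (𝟙 I)).obj x).el = ((𝟭 (V.Fam I)).obj x).el := by
  rw [Functor.id_obj, reindex_el, Category.id_comp]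

/-- Reindexing along the identity is the identity. -/
def reindexId (I : E) : (V.toIntCat.reindex (𝟙 I) : V.Fam I ⥤ V.Fam I) ≅ 𝟭 (V.Fam I) :=
  NatIso.ofComponents (fun x => famIso (V.reindexId_el I x)) fun f => by
    apply fam_hom_ext
    rw [comp_famIso_ar, famIso_comp_ar, Functor.id_map, reindex_map_ar, Category.id_comp]

theorem reindexComp_app {K : E} (r : I ⟶ J) (s : J ⟶ K) (t : I ⟶ K) (w : r ≫ s = t)
    (x : V.Fam K) : V.IsFamId ((V.reindexComp r s t w).hom.app x) :=
  IsFamId.of_famIso (V.reindexComp_el r s t w x)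

theorem reindexId_app (I : E) (x : V.Fam I) : V.IsFamId ((V.reindexId I).hom.app x) :=
  IsFamId.of_famIso (V.reindexId_el I x)

instance {K : E} (r : I ⟶ J) (s : J ⟶ K) (t : I ⟶ K) (w : r ≫ s = t) :
    NatTrans.IsMonoidal (V.reindexComp r s t w).hom where
  unit := ((V.ε_reindex t).comp (V.reindexComp_app r s t w _)).eq
    ((V.ε_reindex r).comp ((V.ε_reindex s).reindex r))
  tensor x y := ((V.μ_reindex t x y).comp (V.reindexComp_app r s t w _)).eq
    (((V.reindexComp_app r s t w x).tensor (V.reindexComp_app r s t w y)).comp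
      ((V.μ_reindex r _ _).comp ((V.μ_reindex s x y).reindex r)))

instance (I : E) : NatTrans.IsMonoidal (V.reindexId I).hom where
  unit := ((V.ε_reindex (𝟙 I)).comp (V.reindexId_app I _)).eq (IsFamId.of_id (𝟙_ (V.Fam I)))
  tensor x y := ((V.μ_reindex (𝟙 I) x y).comp (V.reindexId_app I _)).eq
    (((V.reindexId_app I x).tensor (V.reindexId_app I y)).comp (IsFamId.of_id (x ⊗ y)))

/-- The externalization of an internal monoidal category. -/
@[reducible]
def ext : IndexedMonCat.{v, u, v, v} E where
  fib I := V.Fam I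
  map r := V.toIntCat.reindex r
  mapComp r s t w := V.reindexComp r s t w
  mapId I := V.reindexId I
  map_assoc f g h fg gh fgh w₁ w₂ w₃ w₄ a :=
    ((V.reindexComp_app f gh fgh w₃ a).comp ((V.reindexComp_app g h gh w₂ a).reindex f)).eq
      ((V.reindexComp_app fg h fgh w₄ a).comp (V.reindexComp_app f g fg w₁ _))
  map_id_left f a :=
    ((V.reindexComp_app _ f f (Category.id_comp f) a).comp (V.reindexId_app _ _)).eq
      (IsFamId.of_id _)
  map_id_right f a :=
    ((V.reindexComp_app f _ f (Category.comp_id f) a).comp ((V.reindexId_app _ a).reindex f)).eq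
      (IsFamId.of_id _)

end IntMonCat

section InternalEnriched

open IntCat IntMonCat

variable [CartesianMonoidalCategory E]

/-- The data of an internal `V`-enriched category: an object of `E`, the internal hom, and families
of arrows `comp a b c : hom b c ⊗ hom a b ⟶ hom a c` and `idm a : 𝟙 ⟶ hom a a`. -/
structure IntVCatData (V : IntMonCat E) where
  carrier : E
  hom : carrier ⊗ carrier ⟶ V.ob
  comp : carrier ⊗ carrier ⊗ carrier ⟶ V.ar
  idm : carrier ⟶ V.ar
  comp_src {I : E} (a b c : I ⟶ carrier) : lift a (lift b c) ≫ comp ≫ V.src =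
    lift (lift b c ≫ hom) (lift a b ≫ hom) ≫ V.tensorOb
  comp_tgt {I : E} (a b c : I ⟶ carrier) : lift a (lift b c) ≫ comp ≫ V.tgt = lift a c ≫ hom
  idm_src {I : E} (a : I ⟶ carrier) : a ≫ idm ≫ V.src = toUnit I ≫ V.unit
  idm_tgt {I : E} (a : I ⟶ carrier) : a ≫ idm ≫ V.tgt = lift a a ≫ hom

namespace IntVCatData

variable {V : IntMonCat E} (X : IntVCatData V) {I : E}

/-- The internal hom in context. -/
def homFam (a b : I ⟶ X.carrier) : V.Fam I := ⟨lift a b ≫ X.hom⟩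

/-- Composition in context. -/
def compFam (a b c : I ⟶ X.carrier) : X.homFam b c ⊗ X.homFam a b ⟶ X.homFam a c :=
  FamHom.mk (lift a (lift b c) ≫ X.comp) (by rw [Category.assoc, X.comp_src]; rfl)
    (by rw [Category.assoc, X.comp_tgt]; rfl)

/-- Identities in context. -/
def idFam (a : I ⟶ X.carrier) : 𝟙_ (V.Fam I) ⟶ X.homFam a a :=
  FamHom.mk (a ≫ X.idm) (by rw [Category.assoc, X.idm_src]; rfl)
    (by rw [Category.assoc, X.idm_tgt]; rfl)

end IntVCatData

/-- An internal `V`-enriched category. The axioms hold in context. -/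
structure IntVCat (V : IntMonCat E) extends IntVCatData V where
  assoc {I : E} (a b c d : I ⟶ carrier) :
    toIntVCatData.compFam b c d ▷ toIntVCatData.homFam a b ≫ toIntVCatData.compFam a b d =
      (α_ _ _ _).hom ≫ toIntVCatData.homFam c d ◁ toIntVCatData.compFam a b c ≫
        toIntVCatData.compFam a c d
  id_comp {I : E} (a b : I ⟶ carrier) :
    toIntVCatData.idFam b ▷ toIntVCatData.homFam a b ≫ toIntVCatData.compFam a b b = (λ_ _).hom
  comp_id {I : E} (a b : I ⟶ carrier) :
    toIntVCatData.homFam a b ◁ toIntVCatData.idFam a ≫ toIntVCatData.compFam a a b = (ρ_ _).hom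

variable {V : IntMonCat E}

/-- The fibre over `I` of the externalization of an internal `V`-enriched category: its objects are
the `I`-indexed families of elements of the underlying object. -/
def IntVCat.fibre (X : IntVCat V) (I : E) : VCat.{max v w} (V.Fam I) where
  obj := ULift.{w} (I ⟶ X.carrier)
  hom a b := X.homFam a.down b.down
  idm a := X.idFam a.down
  comp a b c := X.compFam a.down b.down c.down
  assoc a b c d := X.assoc a.down b.down c.down d.down
  id_comp a b := X.id_comp a.down b.down
  comp_id a b := X.comp_id a.down b.down

theorem IntVCat.fam_heq {I : E} {x x' y y' : V.Fam I} {f : x ⟶ y} {f' : x' ⟶ y'} (hx : x = x')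
    (hy : y = y') (h : f.ar = f'.ar) : f ≍ f' := by
  subst hx hy
  exact heq_of_eq (fam_hom_ext h)

/-- The data of a functor of internal `V`-enriched categories: a morphism on objects, and a family
of arrows `map a b : hom a b ⟶ hom (obj a) (obj b)`. -/
structure IntVFunctorData (X Y : IntVCat V) where
  obj : X.carrier ⟶ Y.carrier
  map : X.carrier ⊗ X.carrier ⟶ V.ar
  map_src {I : E} (a b : I ⟶ X.carrier) : lift a b ≫ map ≫ V.src = lift a b ≫ X.hom
  map_tgt {I : E} (a b : I ⟶ X.carrier) :
    lift a b ≫ map ≫ V.tgt = lift (a ≫ obj) (b ≫ obj) ≫ Y.hom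

/-- The action on internal homs in context. -/
def IntVFunctorData.mapFam {X Y : IntVCat V} (F : IntVFunctorData X Y) {I : E}
    (a b : I ⟶ X.carrier) : X.homFam a b ⟶ Y.homFam (a ≫ F.obj) (b ≫ F.obj) :=
  FamHom.mk (lift a b ≫ F.map) (by rw [Category.assoc, F.map_src]; rfl)
    (by rw [Category.assoc, F.map_tgt]; rfl)

/-- A functor of internal `V`-enriched categories. -/
structure IntVFunctor (X Y : IntVCat V) extends IntVFunctorData X Y where
  map_id {I : E} (a : I ⟶ X.carrier) :
    X.idFam a ≫ toIntVFunctorData.mapFam a a = Y.idFam (a ≫ obj)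
  map_comp {I : E} (a b c : I ⟶ X.carrier) :
    X.compFam a b c ≫ toIntVFunctorData.mapFam a c =
      (toIntVFunctorData.mapFam b c ⊗ₘ toIntVFunctorData.mapFam a b) ≫
        Y.compFam (a ≫ obj) (b ≫ obj) (c ≫ obj)

/-- The functor of fibres over `I` given by a functor of internal `V`-enriched categories. -/
def IntVFunctor.fibre {X Y : IntVCat V} (F : IntVFunctor X Y) (I : E) :
    VFunctor (IntVCat.fibre.{w} X I) (IntVCat.fibre.{w} Y I) where
  obj a := ⟨a.down ≫ F.obj⟩
  map a b := F.mapFam a.down b.down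
  map_id a := F.map_id a.down
  map_comp a b c := F.map_comp a.down b.down c.down

/-- The data of a natural transformation of functors of internal `V`-enriched categories: a family
of arrows `app a : 𝟙 ⟶ hom (F a) (G a)`. -/
structure IntVNatData {X Y : IntVCat V} (F G : IntVFunctor X Y) where
  app : X.carrier ⟶ V.ar
  app_src {I : E} (a : I ⟶ X.carrier) : a ≫ app ≫ V.src = toUnit I ≫ V.unit
  app_tgt {I : E} (a : I ⟶ X.carrier) :
    a ≫ app ≫ V.tgt = lift (a ≫ F.obj) (a ≫ G.obj) ≫ Y.hom

/-- The components in context. -/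
def IntVNatData.appFam {X Y : IntVCat V} {F G : IntVFunctor X Y} (α : IntVNatData F G) {I : E}
    (a : I ⟶ X.carrier) : 𝟙_ (V.Fam I) ⟶ Y.homFam (a ≫ F.obj) (a ≫ G.obj) :=
  FamHom.mk (a ≫ α.app) (by rw [Category.assoc, α.app_src]; rfl)
    (by rw [Category.assoc, α.app_tgt]; rfl)

/-- A natural transformation of functors of internal `V`-enriched categories. -/
structure IntVNat {X Y : IntVCat V} (F G : IntVFunctor X Y) extends IntVNatData F G where
  naturality {I : E} (a b : I ⟶ X.carrier) :
    (λ_ (X.homFam a b)).inv ≫ (toIntVNatData.appFam b ⊗ₘ F.mapFam a b) ≫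
        Y.compFam (a ≫ F.obj) (b ≫ F.obj) (b ≫ G.obj) =
      (ρ_ (X.homFam a b)).inv ≫ (G.mapFam a b ⊗ₘ toIntVNatData.appFam a) ≫
        Y.compFam (a ≫ F.obj) (a ≫ G.obj) (b ≫ G.obj)

/-- The component in context, as a morphism of the underlying category of a fibre. -/
def IntVNat.pt {X Y : IntVCat V} {F G : IntVFunctor X Y} (α : IntVNat F G) {I : E}
    (a : I ⟶ X.carrier) : (F.fibre I).obj ⟨a⟩ ⟶ (IntVFunctor.fibre.{w} G I).obj ⟨a⟩ :=
  VCat.Point.mk (α.appFam a)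

/-- The natural transformation of functors of fibres given by a natural transformation of functors
of internal `V`-enriched categories. -/
def IntVNat.fibre {X Y : IntVCat V} {F G : IntVFunctor X Y} (α : IntVNat F G) (I : E) :
    F.fibre I ⟶ IntVFunctor.fibre.{w} G I :=
  VNat.mk (F := F.fibre I) (G := IntVFunctor.fibre.{w} G I) (fun a => α.pt a.down)
    fun a b => α.naturality a.down b.down

theorem IntMonCat.comp_ar_reindex {I J : E} (r : I ⟶ J) {x y z : V.Fam J} {x' y' z' : V.Fam I}
    {f : x ⟶ y} {g : y ⟶ z} {f' : x' ⟶ y'} {g' : y' ⟶ z'} (hf : f'.ar = r ≫ f.ar)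
    (hg : g'.ar = r ≫ g.ar) : FamHom.ar (f' ≫ g') = r ≫ FamHom.ar (f ≫ g) := by
  rw [← reindex_map_ar, Functor.map_comp]
  exact comp_ar_congr hf hg

theorem IntMonCat.tensor_ar_reindex {I J : E} (r : I ⟶ J) {x y z t : V.Fam J}
    {x' y' z' t' : V.Fam I} {f : x ⟶ y} {g : z ⟶ t} {f' : x' ⟶ y'} {g' : z' ⟶ t'}
    (hf : f'.ar = r ≫ f.ar) (hg : g'.ar = r ≫ g.ar) :
    FamHom.ar (f' ⊗ₘ g') = r ≫ FamHom.ar (f ⊗ₘ g) := by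
  rw [tensorHom_ar, tensorHom_ar, hf, hg, comp_lift_assoc]

namespace IntVFunctor

variable {W X Y Z : IntVCat V} {I J : E}

theorem mapFam_ar (F : IntVFunctor X Y) (a b : I ⟶ X.carrier) :
    (F.mapFam a b).ar = lift a b ≫ F.map := rfl

theorem mapFam_ar_reindex (F : IntVFunctor X Y) (r : I ⟶ J) (a b : J ⟶ X.carrier) :
    (F.mapFam (r ≫ a) (r ≫ b)).ar = r ≫ (F.mapFam a b).ar := by
  rw [mapFam_ar, mapFam_ar, comp_lift_assoc]

/-- A functor is determined by its action in context. -/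
theorem ext_fam {F G : IntVFunctor X Y} (h : F.obj = G.obj)
    (h' : ∀ {I : E} (a b : I ⟶ X.carrier), (F.mapFam a b).ar = (G.mapFam a b).ar) : F = G := by
  have e := h' (fst X.carrier X.carrier) (snd X.carrier X.carrier)
  rw [mapFam_ar, mapFam_ar, lift_fst_snd, Category.id_comp, Category.id_comp] at e
  obtain ⟨⟨o, m, _, _⟩, _, _⟩ := F
  obtain ⟨⟨o', m', _, _⟩, _, _⟩ := G
  obtain rfl : o = o' := h
  obtain rfl : m = m' := e
  rfl

/-- The functor which acts on internal homs, in context, by the arrows `m`. -/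
def ofFam (o : X.carrier ⟶ Y.carrier)
    (m : ∀ {I : E} (a b : I ⟶ X.carrier), X.homFam a b ⟶ Y.homFam (a ≫ o) (b ≫ o))
    (hm : ∀ (I J : E) (r : I ⟶ J) (a b : J ⟶ X.carrier),
      (m (r ≫ a) (r ≫ b)).ar = r ≫ (m a b).ar)
    (h₁ : ∀ (I : E) (a : I ⟶ X.carrier), X.idFam a ≫ m a a = Y.idFam (a ≫ o))
    (h₂ : ∀ (I : E) (a b c : I ⟶ X.carrier), X.compFam a b c ≫ m a c =
      (m b c ⊗ₘ m a b) ≫ Y.compFam (a ≫ o) (b ≫ o) (c ≫ o)) : IntVFunctor X Y :=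
  have e {I : E} (a b : I ⟶ X.carrier) : lift a b ≫ (m (fst _ _) (snd _ _)).ar = (m a b).ar := by
    rw [← hm, lift_fst, lift_snd]
  { obj := o
    map := (m (fst _ _) (snd _ _)).ar
    map_src := fun a b => by rw [← Category.assoc, e, (m a b).ar_src]; rfl
    map_tgt := fun a b => by rw [← Category.assoc, e, (m a b).ar_tgt]; rfl
    map_id := fun a => (congrArg _ (fam_hom_ext (e a a))).trans (h₁ _ a)
    map_comp := fun a b c => (congrArg _ (fam_hom_ext (e a c))).trans ((h₂ _ a b c).trans
      (congrArg (· ≫ _) (congrArg₂ _ (fam_hom_ext (e b c)) (fam_hom_ext (e a b))).symm)) }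

theorem ofFam_mapFam_ar {o : X.carrier ⟶ Y.carrier}
    {m : ∀ {I : E} (a b : I ⟶ X.carrier), X.homFam a b ⟶ Y.homFam (a ≫ o) (b ≫ o)}
    {hm : ∀ (I J : E) (r : I ⟶ J) (a b : J ⟶ X.carrier),
      (m (r ≫ a) (r ≫ b)).ar = r ≫ (m a b).ar}
    {h₁ : ∀ (I : E) (a : I ⟶ X.carrier), X.idFam a ≫ m a a = Y.idFam (a ≫ o)}
    {h₂ : ∀ (I : E) (a b c : I ⟶ X.carrier), X.compFam a b c ≫ m a c =
      (m b c ⊗ₘ m a b) ≫ Y.compFam (a ≫ o) (b ≫ o) (c ≫ o)} (a b : I ⟶ X.carrier) :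
    ((ofFam o m hm h₁ h₂).mapFam a b).ar = (m a b).ar := by
  rw [mapFam_ar]
  exact (hm _ _ _ _ _).symm.trans (by rw [lift_fst, lift_snd])

theorem idf_el (a b : I ⟶ X.carrier) :
    (X.homFam a b).el = (X.homFam (a ≫ 𝟙 X.carrier) (b ≫ 𝟙 X.carrier)).el := by
  rw [Category.comp_id, Category.comp_id]

/-- The identity functor. -/
def idf (X : IntVCat V) : IntVFunctor X X :=
  ofFam (𝟙 _) (fun a b => (famIso (idf_el a b)).hom)
    (fun _ _ r a b => by
      rw [famIso_hom_ar, famIso_hom_ar, IntVCatData.homFam, IntVCatData.homFam, ← comp_lift]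
      simp only [Category.assoc])
    (fun _ a => by
      apply fam_hom_ext
      rw [comp_famIso_ar]
      simp [IntVCatData.idFam])
    (fun _ a b c => by
      apply fam_hom_ext
      rw [comp_famIso_ar, ((IsFamId.of_famIso _).tensor (IsFamId.of_famIso _)).comp_ar]
      simp [IntVCatData.compFam])

theorem idf_mapFam (a b : I ⟶ X.carrier) : V.IsFamId ((idf X).mapFam a b) :=
  (ofFam_mapFam_ar a b).trans (IsFamId.of_famIso (idf_el a b))

theorem homFam_congr (X : IntVCat V) {a a' b b' : I ⟶ X.carrier} (h : a = a') (h' : b = b') :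
    (X.homFam a b).el = (X.homFam a' b').el := by
  subst h h'; rfl

theorem compFam_ar_congr (X : IntVCat V) {a a' b b' c c' : I ⟶ X.carrier} (h : a = a')
    (h' : b = b') (h'' : c = c') : (X.compFam a b c).ar = (X.compFam a' b' c').ar := by
  subst h h' h''; rfl

/-- Composition of functors, in diagrammatic order. -/
def comp (F : IntVFunctor X Y) (G : IntVFunctor Y Z) : IntVFunctor X Z :=
  ofFam (F.obj ≫ G.obj)
    (fun a b => (F.mapFam a b ≫ G.mapFam (a ≫ F.obj) (b ≫ F.obj)) ≫
      (famIso (homFam_congr Z (Category.assoc _ _ _) (Category.assoc _ _ _))).hom)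
    (fun _ _ r a b => by
      rw [comp_famIso_ar, comp_famIso_ar]
      refine comp_ar_reindex r (F.mapFam_ar_reindex r a b) ?_
      rw [← G.mapFam_ar_reindex, mapFam_ar, mapFam_ar, Category.assoc, Category.assoc])
    (fun _ a => by
      rw [← Category.assoc (X.idFam a), ← Category.assoc (X.idFam a), F.map_id, G.map_id]
      apply fam_hom_ext
      rw [comp_famIso_ar]
      simp [IntVCatData.idFam])
    (fun _ a b c => by
      rw [← Category.assoc (X.compFam a b c), ← Category.assoc (X.compFam a b c), F.map_comp,
        Category.assoc (F.mapFam b c ⊗ₘ F.mapFam a b), G.map_comp,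
        ← Category.assoc (F.mapFam b c ⊗ₘ F.mapFam a b), tensorHom_comp_tensorHom,
        ← tensorHom_comp_tensorHom (F.mapFam b c ≫ G.mapFam (b ≫ F.obj) (c ≫ F.obj)),
        Category.assoc (F.mapFam b c ≫ _ ⊗ₘ F.mapFam a b ≫ _),
        Category.assoc (F.mapFam b c ≫ _ ⊗ₘ F.mapFam a b ≫ _)]
      apply fam_hom_ext
      refine comp_ar_congr rfl ?_
      rw [comp_famIso_ar, ((IsFamId.of_famIso _).tensor (IsFamId.of_famIso _)).comp_ar]
      exact compFam_ar_congr Z (Category.assoc _ _ _) (Category.assoc _ _ _)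
        (Category.assoc _ _ _))

theorem comp_mapFam_ar (F : IntVFunctor X Y) (G : IntVFunctor Y Z) (a b : I ⟶ X.carrier) :
    ((F.comp G).mapFam a b).ar = FamHom.ar (F.mapFam a b ≫ G.mapFam (a ≫ F.obj) (b ≫ F.obj)) :=
  (ofFam_mapFam_ar a b).trans (comp_famIso_ar _ _)

theorem mapFam_ar_congr (F : IntVFunctor X Y) {a a' b b' : I ⟶ X.carrier} (h : a = a')
    (h' : b = b') : (F.mapFam a b).ar = (F.mapFam a' b').ar := by
  subst h h'; rfl

theorem idf_comp (F : IntVFunctor X Y) : (idf X).comp F = F := by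
  refine ext_fam (Category.id_comp _) fun a b => ?_
  rw [comp_mapFam_ar, (idf_mapFam a b).comp_ar]
  exact F.mapFam_ar_congr (Category.comp_id _) (Category.comp_id _)

theorem comp_idf (F : IntVFunctor X Y) : F.comp (idf Y) = F := by
  refine ext_fam (Category.comp_id _) fun a b => ?_
  rw [comp_mapFam_ar, (idf_mapFam _ _).ar_comp]

theorem assoc (F : IntVFunctor W X) (G : IntVFunctor X Y) (H : IntVFunctor Y Z) :
    (F.comp G).comp H = F.comp (G.comp H) := by
  refine ext_fam (Category.assoc _ _ _) fun a b => ?_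
  rw [comp_mapFam_ar, comp_mapFam_ar]
  have e : FamHom.ar ((F.comp G).mapFam a b ≫ H.mapFam _ _) = FamHom.ar
      ((F.mapFam a b ≫ G.mapFam _ _) ≫ H.mapFam ((a ≫ F.obj) ≫ G.obj) ((b ≫ F.obj) ≫ G.obj)) :=
    comp_ar_congr (comp_mapFam_ar F G a b)
      (H.mapFam_ar_congr (Category.assoc _ _ _).symm (Category.assoc _ _ _).symm)
  rw [e, Category.assoc (F.mapFam a b)]
  exact comp_ar_congr rfl (comp_mapFam_ar G H _ _).symm

theorem fibre_idf (I : E) : IntVFunctor.fibre.{w} (idf X) I = VFunctor.idf (X.fibre I) := by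
  have h : (IntVFunctor.fibre.{w} (idf X) I).obj = fun x => x :=
    funext fun x => ULift.ext _ _ (Category.comp_id _)
  refine VFunctor.eq_of_map h fun x y => ?_
  refine IntVCat.fam_heq rfl ?_ ?_
  · exact congrArg₂ (IntVCat.fibre.{w} X I).hom (congrFun h x) (congrFun h y)
  · exact (idf_mapFam _ _)

theorem fibre_comp (F : IntVFunctor X Y) (G : IntVFunctor Y Z) (I : E) :
    IntVFunctor.fibre.{w} (F.comp G) I = (F.fibre I).comp (G.fibre I) := by
  have h : (IntVFunctor.fibre.{w} (F.comp G) I).obj = ((F.fibre I).comp (G.fibre I)).obj :=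
    funext fun x => ULift.ext _ _ (Category.assoc _ _ _).symm
  refine VFunctor.eq_of_map h fun x y => ?_
  refine IntVCat.fam_heq rfl ?_ ?_
  · exact congrArg₂ (IntVCat.fibre.{w} Z I).hom (congrFun h x) (congrFun h y)
  · exact comp_mapFam_ar F G _ _

end IntVFunctor

namespace IntVNat

variable {W X Y Z : IntVCat V} {I J : E} {F G H : IntVFunctor X Y}

theorem ext_app {α β : IntVNat F G} (h : α.app = β.app) : α = β := by
  obtain ⟨⟨a, _, _⟩, _⟩ := α
  obtain ⟨⟨b, _, _⟩, _⟩ := β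
  obtain rfl : a = b := h
  rfl

/-- The natural transformation given by `app`, for which the components in context are components
of natural transformations of functors of fibres. -/
def ofFibre (app : X.carrier ⟶ V.ar) (N : ∀ I : E, F.fibre I ⟶ IntVFunctor.fibre.{0} G I)
    (h : ∀ (I : E) (a : I ⟶ X.carrier), ((N I).app ⟨a⟩).el.ar = a ≫ app) : IntVNat F G :=
  have e₁ {I : E} (a : I ⟶ X.carrier) : a ≫ app ≫ V.src = toUnit I ≫ V.unit := by
    rw [← Category.assoc, ← h, ((N I).app ⟨a⟩).el.ar_src]; rfl
  have e₂ {I : E} (a : I ⟶ X.carrier) :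
      a ≫ app ≫ V.tgt = lift (a ≫ F.obj) (a ≫ G.obj) ≫ Y.hom := by
    rw [← Category.assoc, ← h, ((N I).app ⟨a⟩).el.ar_tgt]; rfl
  have e {I : E} (a : I ⟶ X.carrier) :
      IntVNatData.appFam (F := F) (G := G) ⟨app, e₁, e₂⟩ a = ((N I).app ⟨a⟩).el :=
    fam_hom_ext (h I a).symm
  { app := app
    app_src := e₁
    app_tgt := e₂
    naturality := fun {I} a b => by
      rw [e, e]
      exact (N I).naturality ⟨a⟩ ⟨b⟩ }

theorem ext_pt {α β : IntVNat F G}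
    (h : ∀ {I : E} (a : I ⟶ X.carrier), IntVNat.pt.{0} α a = IntVNat.pt.{0} β a) : α = β := by
  have e := congrArg (fun p => FamHom.ar (VCat.Point.el p)) (h (𝟙 _))
  exact ext_app ((Category.id_comp _).symm.trans (Eq.trans e (Category.id_comp _)))

/-- Equality of morphisms of the underlying category of a fibre whose domains and codomains are
only equal up to a proof. -/
theorem pt_heq {x y x' y' : (IntVCat.fibre.{w} Y I).obj} {p : x ⟶ y} {p' : x' ⟶ y'} (hx : x = x')
    (hy : y = y') (h : FamHom.ar p.el = FamHom.ar p'.el) : p ≍ p' := by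
  subst hx hy
  exact heq_of_eq (VCat.hom_ext (fam_hom_ext h))

theorem comp_pt_ar_reindex (r : I ⟶ J) {x y z : (IntVCat.fibre.{w} Y J).obj}
    {x' y' z' : (IntVCat.fibre.{w} Y I).obj} {p : x ⟶ y} {q : y ⟶ z} {p' : x' ⟶ y'} {q' : y' ⟶ z'}
    (hx : x'.down = r ≫ x.down) (hy : y'.down = r ≫ y.down) (hz : z'.down = r ≫ z.down)
    (hp : FamHom.ar p'.el = r ≫ FamHom.ar p.el) (hq : FamHom.ar q'.el = r ≫ FamHom.ar q.el) :
    FamHom.ar (p' ≫ q').el = r ≫ FamHom.ar (p ≫ q).el := by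
  refine comp_ar_reindex r ?_ (comp_ar_reindex r (tensor_ar_reindex r hq hp) ?_)
  · rw [leftUnitor_inv_ar, leftUnitor_inv_ar, unit_el, unit_el, Category.assoc, Category.assoc,
      comp_toUnit_assoc]
  · change lift _ (lift _ _) ≫ Y.comp = r ≫ lift _ (lift _ _) ≫ Y.comp
    rw [hx, hy, hz, comp_lift_assoc, comp_lift]

/-- The identity natural transformation. -/
def idn (F : IntVFunctor X Y) : IntVNat F F :=
  ofFibre (F.obj ≫ Y.idm) (fun I => 𝟙 (F.fibre I)) fun _ a => Category.assoc a F.obj Y.idm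

/-- Vertical composition of natural transformations, by composition of components. -/
def comp (α : IntVNat F G) (β : IntVNat G H) : IntVNat F H :=
  ofFibre (FamHom.ar (IntVNat.pt.{0} α (𝟙 _) ≫ IntVNat.pt.{0} β (𝟙 _)).el)
    (fun I => α.fibre I ≫ β.fibre I) fun I a => by
      change FamHom.ar (IntVNat.pt.{0} α a ≫ IntVNat.pt.{0} β a).el = _
      refine comp_pt_ar_reindex a ?_ ?_ ?_ ?_ ?_
      · exact congrArg (a ≫ ·) (Category.id_comp _).symm
      · exact congrArg (a ≫ ·) (Category.id_comp _).symm
      · exact congrArg (a ≫ ·) (Category.id_comp _).symm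
      · exact congrArg (a ≫ ·) (Category.id_comp _).symm
      · exact congrArg (a ≫ ·) (Category.id_comp _).symm

theorem idn_pt (F : IntVFunctor X Y) (a : I ⟶ X.carrier) :
    IntVNat.pt.{0} (idn F) a = 𝟙 _ :=
  VCat.hom_ext (fam_hom_ext (Category.assoc a F.obj Y.idm).symm)

theorem comp_pt (α : IntVNat F G) (β : IntVNat G H) (a : I ⟶ X.carrier) :
    IntVNat.pt.{0} (α.comp β) a = IntVNat.pt.{0} α a ≫ IntVNat.pt.{0} β a := by
  refine VCat.hom_ext (fam_hom_ext (Eq.symm ?_))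
  refine comp_pt_ar_reindex a ?_ ?_ ?_ ?_ ?_
  · exact congrArg (a ≫ ·) (Category.id_comp _).symm
  · exact congrArg (a ≫ ·) (Category.id_comp _).symm
  · exact congrArg (a ≫ ·) (Category.id_comp _).symm
  · exact congrArg (a ≫ ·) (Category.id_comp _).symm
  · exact congrArg (a ≫ ·) (Category.id_comp _).symm

end IntVNat

/-- Functors and natural transformations of internal `V`-enriched categories form a category. -/
instance {X Y : IntVCat V} : Category (IntVFunctor X Y) where
  Hom F G := IntVNat F G
  id F := IntVNat.idn F
  comp α β := α.comp β
  id_comp α := IntVNat.ext_pt fun a => by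
    rw [IntVNat.comp_pt, IntVNat.idn_pt, Category.id_comp]
  comp_id α := IntVNat.ext_pt fun a => by
    rw [IntVNat.comp_pt, IntVNat.idn_pt, Category.comp_id]
  assoc α β γ := IntVNat.ext_pt fun a => by
    rw [IntVNat.comp_pt, IntVNat.comp_pt, IntVNat.comp_pt, IntVNat.comp_pt, Category.assoc]

namespace IntVNat

variable {W X Y Z T : IntVCat V} {I J : E} {F G H : IntVFunctor X Y}

theorem eqToHom_conj_ar {A B : VCat.{v} (V.Fam I)} {P P' Q Q' : VFunctor A B} (h : P' = P)
    (h' : Q = Q') (N : P ⟶ Q) (x : A.obj) :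
    FamHom.ar (VNat.app (eqToHom h ≫ N ≫ eqToHom h') x).el = FamHom.ar (N.app x).el := by
  subst h h'
  simp

theorem pt_congr (α : IntVNat F G) {a b : I ⟶ X.carrier} (h : a = b) :
    IntVNat.pt.{0} α a ≍ IntVNat.pt.{0} α b := by
  subst h; rfl

theorem pmap_heq {A B : VCat.{v} (V.Fam I)} {P Q : VFunctor A B} (h : P = Q) {x y x' y' : A.obj}
    (hx : x = x') (hy : y = y') {p : x ⟶ y} {p' : x' ⟶ y'} (hp : p ≍ p') :
    P.pmap p ≍ Q.pmap p' := by
  subst h hx hy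
  rw [eq_of_heq hp]

/-- The whiskering `L.comp F ⟶ L.comp G` of `α : F ⟶ G`. -/
def whiskerLeft (L : IntVFunctor W X) (α : IntVNat F G) : L.comp F ⟶ L.comp G :=
  ofFibre (L.obj ≫ α.app)
    (fun I => eqToHom (L.fibre_comp F I) ≫ VFunctor.whiskerLeft (L.fibre I) (α.fibre I) ≫
      eqToHom (L.fibre_comp G I).symm)
    fun _ a => (eqToHom_conj_ar _ _ _ _).trans (Category.assoc a L.obj _)

/-- The whiskering `F.comp R ⟶ G.comp R` of `α : F ⟶ G`. -/
def whiskerRight (α : IntVNat F G) (R : IntVFunctor Y Z) : F.comp R ⟶ G.comp R :=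
  ofFibre (FamHom.ar (α.appFam (𝟙 _) ≫ R.mapFam (𝟙 _ ≫ F.obj) (𝟙 _ ≫ G.obj)))
    (fun I => eqToHom (F.fibre_comp R I) ≫ VFunctor.whiskerRight (α.fibre I) (R.fibre I) ≫
      eqToHom (G.fibre_comp R I).symm)
    fun _ a => (eqToHom_conj_ar _ _ _ _).trans <| comp_ar_reindex a
      (congrArg (a ≫ ·) (Category.id_comp _).symm)
      ((R.mapFam_ar_congr (congrArg (a ≫ ·) (Category.id_comp _).symm)
        (congrArg (a ≫ ·) (Category.id_comp _).symm)).trans (R.mapFam_ar_reindex _ _ _))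

theorem comp_obj (F : IntVFunctor X Y) (R : IntVFunctor Y Z) (a : I ⟶ X.carrier) :
    (IntVFunctor.fibre.{0} (F.comp R) I).obj ⟨a⟩ =
      (R.fibre I).obj ((IntVFunctor.fibre.{0} F I).obj ⟨a⟩) :=
  congrArg ULift.up (Category.assoc a F.obj R.obj).symm

theorem whiskerLeft_pt (L : IntVFunctor W X) (α : IntVNat F G) (a : I ⟶ W.carrier) :
    IntVNat.pt.{0} (whiskerLeft L α) a ≍ IntVNat.pt.{0} α (a ≫ L.obj) :=
  pt_heq (comp_obj L F a) (comp_obj L G a) (Category.assoc a L.obj _).symm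

theorem whiskerRight_pt (α : IntVNat F G) (R : IntVFunctor Y Z) (a : I ⟶ X.carrier) :
    IntVNat.pt.{0} (whiskerRight α R) a ≍ (R.fibre I).pmap (IntVNat.pt.{0} α a) := by
  refine pt_heq (comp_obj F R a) (comp_obj G R a) (Eq.symm ?_)
  exact comp_ar_reindex a
      (congrArg (a ≫ ·) (Category.id_comp _).symm)
      ((R.mapFam_ar_congr (congrArg (a ≫ ·) (Category.id_comp _).symm)
        (congrArg (a ≫ ·) (Category.id_comp _).symm)).trans (R.mapFam_ar_reindex _ _ _))

theorem id_pt (F : IntVFunctor X Y) (a : I ⟶ X.carrier) :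
    IntVNat.pt.{0} (𝟙 F) a = 𝟙 _ := idn_pt F a

theorem vcomp_pt (α : F ⟶ G) (β : G ⟶ H) (a : I ⟶ X.carrier) :
    IntVNat.pt.{0} (α ≫ β) a = IntVNat.pt.{0} α a ≫ IntVNat.pt.{0} β a := comp_pt α β a

theorem conj_pt {F' G' : IntVFunctor X Y} (h : F' = F) (α : F ⟶ G) (h' : G = G')
    (a : I ⟶ X.carrier) :
    IntVNat.pt.{0} (eqToHom h ≫ α ≫ eqToHom h') a ≍ IntVNat.pt.{0} α a := by
  subst h h'
  simp only [eqToHom_refl, Category.id_comp, Category.comp_id]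
  rfl

theorem wl_id (L : IntVFunctor W X) (F : IntVFunctor X Y) :
    whiskerLeft L (𝟙 F) = 𝟙 (L.comp F) := ext_pt fun a => by
  refine eq_of_heq ((whiskerLeft_pt L (𝟙 F) a).trans ?_)
  rw [id_pt, id_pt, comp_obj]
  rfl

theorem wl_comp (L : IntVFunctor W X) (α : F ⟶ G) (β : G ⟶ H) :
    whiskerLeft L (α ≫ β) = whiskerLeft L α ≫ whiskerLeft L β := ext_pt fun a => by
  refine eq_of_heq ((whiskerLeft_pt L (α ≫ β) a).trans ?_)
  rw [vcomp_pt, vcomp_pt]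
  exact heq_comp (comp_obj L F a).symm (comp_obj L G a).symm (comp_obj L H a).symm
    (whiskerLeft_pt L α a).symm (whiskerLeft_pt L β a).symm

theorem wr_id (F : IntVFunctor X Y) (R : IntVFunctor Y Z) :
    whiskerRight (𝟙 F) R = 𝟙 (F.comp R) := ext_pt fun a => by
  refine eq_of_heq ((whiskerRight_pt (𝟙 F) R a).trans ?_)
  rw [id_pt, id_pt, VFunctor.pmap_id, comp_obj]

theorem wr_comp (α : F ⟶ G) (β : G ⟶ H) (R : IntVFunctor Y Z) :
    whiskerRight (α ≫ β) R = whiskerRight α R ≫ whiskerRight β R := ext_pt fun a => by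
  refine eq_of_heq ((whiskerRight_pt (α ≫ β) R a).trans ?_)
  rw [vcomp_pt, vcomp_pt, VFunctor.pmap_comp]
  exact heq_comp (comp_obj F R a).symm (comp_obj G R a).symm (comp_obj H R a).symm
    (whiskerRight_pt α R a).symm (whiskerRight_pt β R a).symm

theorem w_exchange {F G : IntVFunctor X Y} {H K : IntVFunctor Y Z} (α : F ⟶ G) (β : H ⟶ K) :
    whiskerLeft F β ≫ whiskerRight α K = whiskerRight α H ≫ whiskerLeft G β := ext_pt fun {I} a => by
  rw [vcomp_pt, vcomp_pt]
  have h₁ : IntVNat.pt.{0} (whiskerLeft F β) a ≫ IntVNat.pt.{0} (whiskerRight α K) a ≍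
      IntVNat.pt.{0} β (a ≫ F.obj) ≫ (K.fibre I).pmap (IntVNat.pt.{0} α a) :=
    heq_comp (comp_obj F H a) (comp_obj F K a) (comp_obj G K a)
      (whiskerLeft_pt F β a) (whiskerRight_pt α K a)
  have h₂ : IntVNat.pt.{0} (whiskerRight α H) a ≫ IntVNat.pt.{0} (whiskerLeft G β) a ≍
      (H.fibre I).pmap (IntVNat.pt.{0} α a) ≫ IntVNat.pt.{0} β (a ≫ G.obj) :=
    heq_comp (comp_obj F H a) (comp_obj G H a) (comp_obj G K a)
      (whiskerRight_pt α H a) (whiskerLeft_pt G β a)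
  have h₃ := VFunctor.pmap_nat (IntVNat.fibre.{0} β I) (IntVNat.pt.{0} α a)
  exact eq_of_heq (h₁.trans ((heq_of_eq h₃.symm).trans h₂.symm))

theorem id_wl (α : F ⟶ G) : whiskerLeft (IntVFunctor.idf X) α =
    eqToHom (IntVFunctor.idf_comp F) ≫ α ≫ eqToHom (IntVFunctor.idf_comp G).symm :=
  ext_pt fun a => eq_of_heq <|
    ((whiskerLeft_pt (IntVFunctor.idf X) α a).trans (pt_congr α (Category.comp_id a))).trans
      (conj_pt (IntVFunctor.idf_comp F) α (IntVFunctor.idf_comp G).symm a).symm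

theorem comp_wl (L : IntVFunctor W X) (M : IntVFunctor X Y) {H H' : IntVFunctor Y Z} (α : H ⟶ H') :
    whiskerLeft (L.comp M) α = eqToHom (IntVFunctor.assoc L M H) ≫
      (show L.comp (M.comp H) ⟶ L.comp (M.comp H') from whiskerLeft L (whiskerLeft M α)) ≫
      eqToHom (IntVFunctor.assoc L M H').symm :=
  ext_pt fun a => eq_of_heq <|
    ((whiskerLeft_pt (L.comp M) α a).trans (pt_congr α (Category.assoc a L.obj M.obj).symm)).trans <|
      ((whiskerLeft_pt M α (a ≫ L.obj)).symm.trans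
        (whiskerLeft_pt L (whiskerLeft M α) a).symm).trans
        (conj_pt (IntVFunctor.assoc L M H) (whiskerLeft L (whiskerLeft M α))
          (IntVFunctor.assoc L M H').symm a).symm

theorem id_wr (α : F ⟶ G) : whiskerRight α (IntVFunctor.idf Y) =
    eqToHom (IntVFunctor.comp_idf F) ≫ α ≫ eqToHom (IntVFunctor.comp_idf G).symm :=
  ext_pt fun {I} a => by
    have h : ((IntVFunctor.idf Y).fibre I).pmap (IntVNat.pt.{0} α a) ≍ IntVNat.pt.{0} α a :=
      (pmap_heq (IntVFunctor.fibre_idf I) rfl rfl HEq.rfl).trans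
        (heq_of_eq (VFunctor.idf_pmap _))
    exact eq_of_heq (((whiskerRight_pt α (IntVFunctor.idf Y) a).trans h).trans
      (conj_pt (IntVFunctor.comp_idf F) α (IntVFunctor.comp_idf G).symm a).symm)

theorem comp_wr (α : F ⟶ G) (R : IntVFunctor Y Z) (S : IntVFunctor Z T) :
    whiskerRight α (R.comp S) = eqToHom (IntVFunctor.assoc F R S).symm ≫
      (show (F.comp R).comp S ⟶ (G.comp R).comp S from whiskerRight (whiskerRight α R) S) ≫
      eqToHom (IntVFunctor.assoc G R S) :=
  ext_pt fun {I} a => by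
    have h : ((R.comp S).fibre I).pmap (IntVNat.pt.{0} α a) ≍
        (S.fibre I).pmap ((R.fibre I).pmap (IntVNat.pt.{0} α a)) :=
      (pmap_heq (IntVFunctor.fibre_comp R S I) rfl rfl HEq.rfl).trans
        (heq_of_eq (VFunctor.comp_pmap _ _ _))
    have h' : (S.fibre I).pmap (IntVNat.pt.{0} (whiskerRight α R) a) ≍
        (S.fibre I).pmap ((R.fibre I).pmap (IntVNat.pt.{0} α a)) :=
      pmap_heq rfl (comp_obj F R a) (comp_obj G R a) (whiskerRight_pt α R a)
    exact eq_of_heq (((whiskerRight_pt α (R.comp S) a).trans h).trans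
      ((h'.symm.trans (whiskerRight_pt (whiskerRight α R) S a).symm).trans
      (conj_pt (IntVFunctor.assoc F R S).symm (whiskerRight (whiskerRight α R) S)
        (IntVFunctor.assoc G R S) a).symm))

theorem wl_wr (L : IntVFunctor W X) (α : F ⟶ G) (R : IntVFunctor Y Z) :
    whiskerRight (whiskerLeft L α) R = eqToHom (IntVFunctor.assoc L F R) ≫
      (show L.comp (F.comp R) ⟶ L.comp (G.comp R) from whiskerLeft L (whiskerRight α R)) ≫
      eqToHom (IntVFunctor.assoc L G R).symm :=
  ext_pt fun {I} a => by
    have h : (R.fibre I).pmap (IntVNat.pt.{0} (whiskerLeft L α) a) ≍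
        (R.fibre I).pmap (IntVNat.pt.{0} α (a ≫ L.obj)) :=
      pmap_heq rfl (comp_obj L F a) (comp_obj L G a) (whiskerLeft_pt L α a)
    exact eq_of_heq (((whiskerRight_pt (whiskerLeft L α) R a).trans h).trans
      (((whiskerRight_pt α R (a ≫ L.obj)).symm.trans
        (whiskerLeft_pt L (whiskerRight α R) a).symm).trans
      (conj_pt (IntVFunctor.assoc L F R) (whiskerLeft L (whiskerRight α R))
        (IntVFunctor.assoc L G R).symm a).symm))

theorem wl_eqToHom (L : IntVFunctor W X) {F G : IntVFunctor X Y} (h : F = G) :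
    whiskerLeft L (eqToHom h) = eqToHom (congrArg L.comp h) := by
  subst h
  exact wl_id L F

theorem wr_eqToHom {F G : IntVFunctor X Y} (h : F = G) (R : IntVFunctor Y Z) :
    whiskerRight (eqToHom h) R = eqToHom (congrArg (fun F => F.comp R) h) := by
  subst h
  exact wr_id F R

theorem wpentagon {U : IntVCat V} (L : IntVFunctor W X) (M : IntVFunctor X Y)
    (P : IntVFunctor Y Z) (Q : IntVFunctor Z U) :
    whiskerRight (eqToHom (IntVFunctor.assoc L M P)) Q ≫
        eqToHom (IntVFunctor.assoc L (M.comp P) Q) ≫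
          whiskerLeft L (eqToHom (IntVFunctor.assoc M P Q)) =
      eqToHom (IntVFunctor.assoc (L.comp M) P Q) ≫
        eqToHom (IntVFunctor.assoc L M (P.comp Q)) := by
  rw [wl_eqToHom, wr_eqToHom]
  simp only [eqToHom_trans]

theorem wtriangle (L : IntVFunctor W X) (M : IntVFunctor X Y) :
    eqToHom (IntVFunctor.assoc L (IntVFunctor.idf X) M) ≫
        whiskerLeft L (eqToHom (IntVFunctor.idf_comp M)) =
      whiskerRight (eqToHom (IntVFunctor.comp_idf L)) M := by
  rw [wl_eqToHom, wr_eqToHom]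
  simp only [eqToHom_trans]

end IntVNat

open IntVNat in
/-- The 2-category of internal `V`-enriched categories. -/
instance : Bicategory (IntVCat V) where
  Hom X Y := IntVFunctor X Y
  id X := IntVFunctor.idf X
  comp F G := F.comp G
  whiskerLeft F _ _ α := IntVNat.whiskerLeft F α
  whiskerRight α G := IntVNat.whiskerRight α G
  associator F G H := eqToIso (IntVFunctor.assoc F G H)
  leftUnitor F := eqToIso (IntVFunctor.idf_comp F)
  rightUnitor F := eqToIso (IntVFunctor.comp_idf F)
  whiskerLeft_id F G := wl_id F G
  whiskerLeft_comp F _ _ _ α β := wl_comp F α β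
  id_whiskerLeft α := id_wl α
  comp_whiskerLeft F G _ _ α := comp_wl F G α
  id_whiskerRight F G := wr_id F G
  comp_whiskerRight α β R := wr_comp α β R
  whiskerRight_id α := id_wr α
  whiskerRight_comp α R S := comp_wr α R S
  whisker_assoc F _ _ α R := wl_wr F α R
  whisker_exchange α β := w_exchange α β
  pentagon F G H K := wpentagon F G H K
  triangle F G := wtriangle F G

/-- Composition of functors of internal `V`-enriched categories is strictly associative and
unital. -/
instance : Bicategory.Strict (IntVCat V) where
  id_comp {X Y} F := IntVFunctor.idf_comp (X := X) (Y := Y) F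
  comp_id {X Y} F := IntVFunctor.comp_idf (X := X) (Y := Y) F
  assoc {X Y Z T} F G H := IntVFunctor.assoc (W := X) (X := Y) (Y := Z) (Z := T) F G H
  leftUnitor_eqToIso _ := rfl
  rightUnitor_eqToIso _ := rfl
  associator_eqToIso _ _ _ := rfl

/-- A morphism of the underlying category of a fibre which is an identity up to an equality of
objects. -/
def IsPtId {A : Type*} [Category A] {x y : A} (p : x ⟶ y) : Prop := ∃ h : x = y, p = eqToHom h

namespace IsPtId

variable {A : Type*} [Category A]

theorem of_eq {x y : A} (h : x = y) : IsPtId (eqToHom h) := ⟨h, rfl⟩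

theorem of_id (x : A) : IsPtId (𝟙 x) := ⟨rfl, rfl⟩

theorem comp {x y z : A} {p : x ⟶ y} {q : y ⟶ z} (hp : IsPtId p) (hq : IsPtId q) :
    IsPtId (p ≫ q) := by
  obtain ⟨rfl, rfl⟩ := hp
  obtain ⟨rfl, rfl⟩ := hq
  exact ⟨rfl, Category.id_comp _⟩

theorem eq {x y : A} {p q : x ⟶ y} (hp : IsPtId p) (hq : IsPtId q) : p = q := by
  obtain ⟨h, rfl⟩ := hp
  obtain ⟨_, rfl⟩ := hq
  rfl

theorem pmap {I : E} {A B : VCat.{max v w} (V.Fam I)} (P : VFunctor A B) {x y : A.obj} {p : x ⟶ y}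
    (hp : IsPtId p) : IsPtId (P.pmap p) := by
  obtain ⟨rfl, rfl⟩ := hp
  exact ⟨rfl, P.pmap_id _⟩

theorem lc {I : E} {A : VCat.{max v w} (V.Fam I)} {x y : A.obj} {p : x ⟶ y} (hp : IsPtId p)
    (z : A.obj) : V.IsFamId (A.lc p z) := by
  obtain ⟨rfl, rfl⟩ := hp
  rw [eqToHom_refl, VCat.lc_id]
  exact IsFamId.of_id _

theorem rc {I : E} {A : VCat.{max v w} (V.Fam I)} {x y : A.obj} {p : x ⟶ y} (hp : IsPtId p)
    (z : A.obj) : V.IsFamId (A.rc p z) := by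
  obtain ⟨rfl, rfl⟩ := hp
  rw [eqToHom_refl, VCat.rc_id]
  exact IsFamId.of_id _

theorem ar_comp {I : E} {A : VCat.{max v w} (V.Fam I)} {x y z : A.obj} {p : x ⟶ y} {q : y ⟶ z}
    (hq : IsPtId q) : FamHom.ar (p ≫ q).el = FamHom.ar p.el := by
  obtain ⟨rfl, rfl⟩ := hq
  rw [eqToHom_refl, Category.comp_id]

theorem comp_ar {I : E} {A : VCat.{max v w} (V.Fam I)} {x y z : A.obj} {p : x ⟶ y} {q : y ⟶ z}
    (hp : IsPtId p) : FamHom.ar (p ≫ q).el = FamHom.ar q.el := by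
  obtain ⟨rfl, rfl⟩ := hp
  rw [eqToHom_refl, Category.id_comp]

end IsPtId

namespace IntVCat

variable (X Y : IntVCat V) {I J K : E}

theorem homFam_reindex (f : I ⟶ J) (a b : J ⟶ X.carrier) :
    ((V.toIntCat.reindex f).obj (X.homFam a b)).el = (X.homFam (f ≫ a) (f ≫ b)).el := by
  rw [reindex_el]
  exact comp_lift_assoc _ _ _ _

/-- Reindexing in the externalization: precomposition on objects and identities on homs. -/
def fibreRe (f : I ⟶ J) : VFunctor ((IntVCat.fibre.{w} X J).bc (V.toIntCat.reindex f))
    (IntVCat.fibre.{w} X I) where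
  obj a := ⟨f ≫ a.down⟩
  map a b := (famIso (X.homFam_reindex f a.down b.down)).hom
  map_id a := by
    apply fam_hom_ext
    refine (comp_famIso_ar (X.homFam_reindex f a.down a.down) _).trans ?_
    exact ((V.ε_reindex f).comp_ar _).trans (Category.assoc f a.down X.idm).symm
  map_comp a b c := by
    apply fam_hom_ext
    refine (comp_famIso_ar (X.homFam_reindex f a.down c.down) _).trans (Eq.trans ?_
      (((IsFamId.of_famIso (X.homFam_reindex f b.down c.down)).tensor
        (IsFamId.of_famIso (X.homFam_reindex f a.down b.down))).comp_ar _).symm)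
    refine ((V.μ_reindex f _ _).comp_ar _).trans ?_
    change f ≫ lift _ (lift _ _) ≫ X.comp = lift _ (lift _ _) ≫ X.comp
    rw [comp_lift_assoc, comp_lift]

theorem fibreRe_map (f : I ⟶ J) (a b : (IntVCat.fibre.{w} X J).obj) :
    V.IsFamId ((fibreRe X f).map a b) :=
  IsFamId.of_famIso (X.homFam_reindex f a.down b.down)

theorem fibreRe_pmap_ar (f : I ⟶ J) {a b : (IntVCat.fibre.{w} X J).obj} (p : a ⟶ b) :
    FamHom.ar ((fibreRe X f).bcMap p).el = f ≫ FamHom.ar p.el :=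
  ((fibreRe_map X f a b).ar_comp _).trans ((V.ε_reindex f).comp_ar _)

theorem fibreRe_pmap {f : I ⟶ J} {a b : (IntVCat.fibre.{w} X J).obj} {p : a ⟶ b} (hp : IsPtId p) :
    IsPtId ((fibreRe X f).bcMap p) := by
  obtain ⟨rfl, rfl⟩ := hp
  exact ⟨rfl, VFunctor.bcMap_id _ _⟩

theorem fibreReComp_obj (f : I ⟶ J) (g : J ⟶ K) (h : I ⟶ K) (e : f ≫ g = h)
    (a : (IntVCat.fibre.{w} X K).obj) :
    (fibreRe X h).obj a = (fibreRe X f).obj ((fibreRe X g).obj a) := by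
  subst e
  exact congrArg ULift.up (Category.assoc _ _ _)

/-- Reindexing along a composite agrees with iterated reindexing, up to identities. -/
def fibreReComp (f : I ⟶ J) (g : J ⟶ K) (h : I ⟶ K) (e : f ≫ g = h) :
    fibreRe.{w} X h ≅ (VFunctor.bcComp (V.toIntCat.reindex g) (V.toIntCat.reindex f)
      (V.toIntCat.reindex h) (V.reindexComp f g h e).hom (X.fibre K)).comp
        (((fibreRe X g).bc (V.toIntCat.reindex f)).comp (fibreRe X f)) :=
  VFunctor.isoMk (fun a => eqToIso (X.fibreReComp_obj f g h e a))
    fun a b => ((fibreRe_map X h a b).comp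
      ((IsPtId.of_eq (X.fibreReComp_obj f g h e b)).lc _)).eq
      (((V.reindexComp_app f g h e _).comp (((fibreRe_map X g a b).reindex f).comp
        (fibreRe_map X f _ _))).comp ((IsPtId.of_eq (X.fibreReComp_obj f g h e a)).rc _))

theorem fibreReId_obj (a : (IntVCat.fibre.{w} X I).obj) : (fibreRe X (𝟙 I)).obj a = a :=
  congrArg ULift.up (Category.id_comp _)

/-- Reindexing along an identity is the identity, up to identities. -/
def fibreReId (I : E) : fibreRe.{w} X (𝟙 I) ≅
    VFunctor.bcId (V.toIntCat.reindex (𝟙 I)) (V.reindexId I).hom (X.fibre I) :=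
  VFunctor.isoMk (fun a => eqToIso (X.fibreReId_obj a))
    fun a b => ((fibreRe_map X (𝟙 I) a b).comp ((IsPtId.of_eq (X.fibreReId_obj b)).lc _)).eq
      ((V.reindexId_app I _).comp ((IsPtId.of_eq (X.fibreReId_obj a)).rc _))

/-- The data of the externalization of an internal `V`-enriched category. -/
def extData (X : IntVCat V) : IndexedCatData.{max v w} V.ext where
  fib I := X.fibre I
  re f := X.fibreRe f
  re_fullyFaithful f a b := (famIso (X.homFam_reindex f a.down b.down)).isIso_hom
  compIso f g h e := X.fibreReComp f g h e
  idIso I := X.fibreReId I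

theorem extData_compC (f : I ⟶ J) (g : J ⟶ K) (h : I ⟶ K) (e : f ≫ g = h)
    (a : (IntVCat.fibre.{w} X K).obj) : IsPtId ((extData.{w} X).compC f g h e a).hom :=
  IsPtId.of_eq (X.fibreReComp_obj f g h e a)

theorem extData_idC (a : (IntVCat.fibre.{w} X I).obj) : IsPtId ((extData.{w} X).idC I a).hom :=
  IsPtId.of_eq (X.fibreReId_obj a)

/-- The externalization of an internal `V`-enriched category. -/
def ext (X : IntVCat V) : IndexedCat.{max v w} V.ext where
  toIndexedCatData := extData.{w} X
  comp_assoc f g h fg gh fgh w₁ w₂ w₃ w₄ b :=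
    ((X.extData_compC f gh fgh w₃ b).comp (fibreRe_pmap X (X.extData_compC g h gh w₂ b))).eq
      ((X.extData_compC fg h fgh w₄ b).comp (X.extData_compC f g fg w₁ _))
  id_left f b :=
    ((X.extData_compC _ f f (Category.id_comp f) b).comp (X.extData_idC _)).eq (IsPtId.of_id _)
  id_right f b :=
    ((X.extData_compC f _ f (Category.comp_id f) b).comp (fibreRe_pmap X (X.extData_idC b))).eq
      (IsPtId.of_id _)

end IntVCat

namespace IntVFunctor

variable {X Y : IntVCat V} (F : IntVFunctor X Y) {I J : E}

theorem fibreRe_obj (f : I ⟶ J) (a : (IntVCat.fibre.{w} X J).obj) :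
    (F.fibre I).obj ((X.fibreRe f).obj a) = (Y.fibreRe f).obj ((F.fibre J).obj a) :=
  congrArg ULift.up (Category.assoc _ _ _)

/-- The functors of fibres commute with reindexing, up to identities. -/
def fibreRe (f : I ⟶ J) : (X.fibreRe f).comp (IntVFunctor.fibre.{w} F I) ≅
    ((F.fibre J).bc (V.toIntCat.reindex f)).comp (Y.fibreRe f) :=
  VFunctor.isoMk (fun a => eqToIso (F.fibreRe_obj f a)) fun a b => by
    apply fam_hom_ext
    refine (((IsPtId.of_eq (F.fibreRe_obj f b)).lc _).ar_comp _).trans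
      (Eq.trans ?_ (((IsPtId.of_eq (F.fibreRe_obj f a)).rc _).ar_comp _).symm)
    exact ((X.fibreRe_map f a b).comp_ar _).trans ((F.mapFam_ar_reindex f a.down b.down).trans
      ((Y.fibreRe_map f ((F.fibre J).obj a) ((F.fibre J).obj b)).ar_comp
        ((V.toIntCat.reindex f).map ((IntVFunctor.fibre.{w} F J).map a b))).symm)

/-- The data of the externalization of a functor of internal `V`-enriched categories. -/
def extData : IndexedFunctorData (IntVCat.ext.{w} X) (IntVCat.ext.{w} Y) where
  app I := F.fibre I
  iso f := F.fibreRe f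

theorem extData_isoC (f : I ⟶ J) (a : (IntVCat.fibre.{w} X J).obj) :
    IsPtId ((extData.{w} F).isoC f a).hom :=
  IsPtId.of_eq (F.fibreRe_obj f a)

/-- The externalization of a functor of internal `V`-enriched categories. -/
def ext : IndexedFunctor (IntVCat.ext.{w} X) (IntVCat.ext.{w} Y) where
  toIndexedFunctorData := extData.{w} F
  iso_comp f g h e a :=
    ((IsPtId.pmap (F.fibre _) (X.extData_compC f g h e a)).comp ((F.extData_isoC f _).comp
      (Y.fibreRe_pmap (F.extData_isoC g a)))).eq
      ((F.extData_isoC h a).comp (Y.extData_compC f g h e _))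
  iso_id I a := ((F.extData_isoC (𝟙 I) a).comp (Y.extData_idC _)).eq
    (IsPtId.pmap (F.fibre I) (X.extData_idC a))

end IntVFunctor

/-- The externalization of a natural transformation. -/
def IntVNat.ext {X Y : IntVCat V} {F G : IntVFunctor X Y} (α : IntVNat F G) :
    IndexedNat (IntVFunctor.ext.{w} F) (IntVFunctor.ext.{w} G) where
  app I := α.fibre I
  naturality f a := by
    refine VCat.hom_ext (fam_hom_ext ?_)
    refine (IsPtId.ar_comp (G.extData_isoC f a)).trans
      (Eq.trans ?_ (IsPtId.comp_ar (F.extData_isoC f a)).symm)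
    exact (Category.assoc f a.down α.app).trans (Y.fibreRe_pmap_ar f (IntVNat.pt.{w} α a.down)).symm

variable (V) in
/-- Externalization, on 0-cells, 1-cells and 2-cells. -/
def externalization : PrelaxFunctorStruct (IntVCat V) (IndexedCat.{max v w} V.ext) where
  obj X := X.ext
  map F := IntVFunctor.ext F
  map₂ α := IntVNat.ext α

end InternalEnriched

end Internal

end InternalEnrichment

universe w v u

/-!
Externalization only involves families, which are arrows of `E`. Accordingly, almost every
equality is an equality between the underlying arrows `I ⟶ V.ar`, up to morphisms whose underlying
arrow is an identity family.

Strict 2-functoriality: the functors of fibres of `Ext (F ≫ G)` and `Ext F ≫ Ext G` agree, and all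
comparison isomorphisms are identities up to equality of objects, so that the two indexed functors
are equal (`IndexedFunctor.eq_of_isPtId`). The operations on 2-cells agree in context.

The rest is a Yoneda argument. Every object `a : I ⟶ X` of the fibre over `I` is the reindexing
along `a` of the generic element `𝟙 X`, an object of the fibre over `X`. An indexed natural
transformation between externalizations is therefore determined by its component at the generic
element, and this component is an internal natural transformation: `Ext` is locally fully faithful
(`IntVNat.ext_injective`, `IntVNat.ext_ofExt`).

Let `G` be an indexed functor from `Ext X` to `Ext Y`, with value `F₀ : X ⟶ Y` at the generic
element. The comparison isomorphisms of `G` give isomorphisms `G a ≅ a ≫ F₀` for all `a`, and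
compatibility with composites makes these stable under reindexing (`IndexedFunctor.isoC_genIso`).
Conjugating the action of `G` on homs by them gives functors of fibres which are isomorphic to those
of `G` and commute with reindexing up to identities. Their action on homs is hence given by a single
arrow `X ⊗ X ⟶ V.ar`, its value at the two projections (`IndexedFunctor.straighten_map_ar`), and
this is the internal functor whose externalization is isomorphic to `G`
(`IndexedFunctor.extToIntIso`).
-/

namespace InternalEnrichment

noncomputable section Externalization

open IntCat IntMonCat

variable {E : Type u} [Category.{v} E] [HasFiniteLimits E] [CartesianMonoidalCategory E]
  {V : IntMonCat E}

/-! ### Strict 2-functoriality -/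

namespace IndexedFunctor

/-- Indexed functors into an externalization are equal if their functors of fibres are and all
comparison isomorphisms have identities as components. -/
theorem eq_of_isPtId {B : IndexedCat.{max v w} V.ext} {Y : IntVCat V}
    {F G : IndexedFunctor B (IntVCat.ext.{w} Y)} (h : ∀ I, F.app I = G.app I)
    (hF : ∀ {I J : E} (f : I ⟶ J) (b : (B.fib J).obj), IsPtId (F.isoC f b).hom)
    (hG : ∀ {I J : E} (f : I ⟶ J) (b : (B.fib J).obj), IsPtId (G.isoC f b).hom) : F = G := by
  refine eq_of_isoC h fun {I J} f b => ?_
  obtain ⟨e, he⟩ := hF f b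
  obtain ⟨e', he'⟩ := hG f b
  rw [he, he']
  have h₁ : (F.app I).obj (B.reObj f b) = (G.app I).obj (B.reObj f b) := by rw [h]
  have h₂ : (F.app J).obj b = (G.app J).obj b := by rw [h]
  clear he he'
  revert e e'
  rw [h₁, h₂]
  intro e e'
  rfl

theorem eqToHom_conj_ar {B : IndexedCat.{max v w} V.ext} {Y : IntVCat V}
    {P P' Q Q' : IndexedFunctor B (IntVCat.ext.{w} Y)} (h : P' = P) (h' : Q = Q') (N : P ⟶ Q)
    (I : E) (b : (B.fib I).obj) :
    FamHom.ar (VNat.app (IndexedNat.app (eqToHom h ≫ N ≫ eqToHom h') I) b).el =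
      FamHom.ar (VNat.app (N.app I) b).el := by
  subst h h'
  simp

end IndexedFunctor

namespace IntVFunctor

variable {X Y Z : IntVCat V}

theorem ext_idf (X : IntVCat V) :
    ext.{w} (idf X) = IndexedFunctor.idf (IntVCat.ext.{w} X) :=
  IndexedFunctor.eq_of_isPtId (fun I => fibre_idf I) (fun f a => (idf X).extData_isoC f a)
    fun _ _ => IsPtId.of_id _

theorem ext_comp (F : IntVFunctor X Y) (G : IntVFunctor Y Z) :
    ext.{w} (F.comp G) = (ext.{w} F).comp (ext.{w} G) :=
  IndexedFunctor.eq_of_isPtId (fun I => fibre_comp F G I) (fun f a => (F.comp G).extData_isoC f a)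
    fun f a => (IsPtId.pmap (G.fibre _) (F.extData_isoC f a)).comp (G.extData_isoC f _)

end IntVFunctor

namespace IntVNat

variable {X Y Z : IntVCat V}

/-- Natural transformations into an externalization are equal if the underlying families of arrows
of their components are. -/
theorem indexedNat_ext {B : IndexedCat.{max v w} V.ext} {F G : IndexedFunctor B (IntVCat.ext.{w} Y)}
    {α β : F ⟶ G}
    (h : ∀ I b, FamHom.ar ((α.app I).app b).el = FamHom.ar ((β.app I).app b).el) : α = β :=
  IndexedFunctor.nat_ext fun I b => VCat.hom_ext (fam_hom_ext (h I b))

theorem ext_id (F : IntVFunctor X Y) : ext.{w} (𝟙 F) = 𝟙 (IntVFunctor.ext.{w} F) :=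
  indexedNat_ext fun _ a => (Category.assoc a.down F.obj Y.idm).symm

theorem ext_vcomp {F G H : IntVFunctor X Y} (α : F ⟶ G) (β : G ⟶ H) :
    ext.{w} (α ≫ β) = (show IntVFunctor.ext.{w} F ⟶ _ from ext.{w} α) ≫
      (show _ ⟶ IntVFunctor.ext.{w} H from ext.{w} β) :=
  indexedNat_ext fun _ a =>
    congrArg (fun p => FamHom.ar (VCat.Point.el p)) (vcomp_pt α β a.down)

theorem ext_whiskerLeft (L : IntVFunctor X Y) {F G : IntVFunctor Y Z} (α : F ⟶ G) :
    ext.{w} (whiskerLeft L α) = eqToHom (L.ext_comp F) ≫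
      IndexedFunctor.whiskerLeft (IntVFunctor.ext.{w} L)
        (show IntVFunctor.ext.{w} F ⟶ IntVFunctor.ext.{w} G from ext.{w} α) ≫
      eqToHom (L.ext_comp G).symm :=
  indexedNat_ext fun _ a => Eq.symm <| (IndexedFunctor.eqToHom_conj_ar _ _ _ _ _).trans
    (Category.assoc a.down L.obj α.app)

theorem ext_whiskerRight {F G : IntVFunctor X Y} (α : F ⟶ G) (R : IntVFunctor Y Z) :
    ext.{w} (whiskerRight α R) = eqToHom (F.ext_comp R) ≫
      IndexedFunctor.whiskerRight
        (show IntVFunctor.ext.{w} F ⟶ IntVFunctor.ext.{w} G from ext.{w} α)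
        (IntVFunctor.ext.{w} R) ≫
      eqToHom (G.ext_comp R).symm :=
  indexedNat_ext fun _ a => Eq.symm <| (IndexedFunctor.eqToHom_conj_ar _ _ _ _ _).trans <|
    comp_ar_reindex a.down
      (congrArg (a.down ≫ ·) (Category.id_comp _).symm)
      ((R.mapFam_ar_congr (congrArg (a.down ≫ ·) (Category.id_comp _).symm)
        (congrArg (a.down ≫ ·) (Category.id_comp _).symm)).trans (R.mapFam_ar_reindex _ _ _))

end IntVNat

variable (V) in
/-- Externalization as a strict 2-functor. -/
def extPseudofunctor : StrictPseudofunctor (IntVCat V) (IndexedCat.{max v w} V.ext) :=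
  StrictPseudofunctor.mk''
    { externalization.{w} V with
      map₂_id := fun F => IntVNat.ext_id F
      map₂_comp := fun α β => IntVNat.ext_vcomp α β
      map_id := fun X => IntVFunctor.ext_idf X
      map_comp := fun F G => IntVFunctor.ext_comp F G
      map₂_whisker_left := fun L _ _ α => IntVNat.ext_whiskerLeft L α
      map₂_whisker_right := fun α R => IntVNat.ext_whiskerRight α R }

/-! ### Local faithfulness and fullness -/

/-- The generic element of an internal enriched category: the identity of the underlying object,
as an object of the fibre over it. -/
def IntVCat.gen (X : IntVCat V) : (IntVCat.fibre.{w} X X.carrier).obj := ⟨𝟙 X.carrier⟩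

theorem IntVCat.eq_fibreRe_gen (X : IntVCat V) {I : E} (a : (IntVCat.fibre.{w} X I).obj) :
    a = (X.fibreRe a.down).obj X.gen :=
  congrArg ULift.up (Category.comp_id a.down).symm

namespace IntVNat

variable {X Y : IntVCat V} {F G : IntVFunctor X Y}

theorem ext_injective :
    Function.Injective (fun α : IntVNat F G => IntVNat.ext.{w} α) := fun α β h => by
  have e : FamHom.ar (((ext.{w} α).app _).app X.gen).el =
      FamHom.ar (((ext.{w} β).app _).app X.gen).el :=
    congrArg (fun N : IndexedNat (IntVFunctor.ext.{w} F) (IntVFunctor.ext.{w} G) =>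
      FamHom.ar ((N.app _).app X.gen).el) h
  exact ext_app ((Category.id_comp _).symm.trans (e.trans (Category.id_comp _)))

/-- The components of an indexed natural transformation between externalizations are stable under
reindexing. -/
theorem indexedNat_app_ar
    (N : IndexedNat (IntVFunctor.ext.{w} F) (IntVFunctor.ext.{w} G)) {I J : E} (f : I ⟶ J)
    (a : (IntVCat.fibre.{w} X J).obj) :
    FamHom.ar ((N.app I).app ((X.fibreRe f).obj a)).el = f ≫ FamHom.ar ((N.app J).app a).el := by
  have h := congrArg (fun p => FamHom.ar (VCat.Point.el p)) (N.naturality f a)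
  exact ((IsPtId.ar_comp (G.extData_isoC f a)).symm.trans h).trans
    ((IsPtId.comp_ar (F.extData_isoC f a)).trans (Y.fibreRe_pmap_ar f ((N.app J).app a)))

/-- Every family is a reindexing of the generic one, so that an indexed natural transformation is
determined by its component at the generic element. -/
theorem indexedNat_app_ar_gen
    (N : IndexedNat (IntVFunctor.ext.{w} F) (IntVFunctor.ext.{w} G)) {I : E}
    (a : (IntVCat.fibre.{w} X I).obj) :
    FamHom.ar ((N.app I).app a).el = a.down ≫ FamHom.ar ((N.app X.carrier).app X.gen).el :=
  Eq.trans
    (congrArg (fun a : (IntVCat.fibre.{w} X I).obj => FamHom.ar ((N.app I).app a).el)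
      (X.eq_fibreRe_gen a))
    (indexedNat_app_ar N a.down X.gen)

/-- The internal natural transformation with a given externalization. -/
def ofExt (N : IndexedNat (IntVFunctor.ext.{w} F) (IntVFunctor.ext.{w} G)) : IntVNat F G :=
  ofFibre (FamHom.ar ((N.app X.carrier).app X.gen).el)
    (fun I => VNat.mk (F := F.fibre I) (G := IntVFunctor.fibre.{0} G I)
      (fun a => VCat.Point.mk ((N.app I).app (ULift.up.{w} a.down)).el)
      fun a b => (N.app I).naturality (ULift.up.{w} a.down) (ULift.up.{w} b.down))
    fun _ a => indexedNat_app_ar_gen N (ULift.up.{w} a)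

theorem ext_ofExt (N : IndexedNat (IntVFunctor.ext.{w} F) (IntVFunctor.ext.{w} G)) :
    ext.{w} (ofExt N) = N :=
  indexedNat_ext fun _ a => (indexedNat_app_ar_gen N a).symm

end IntVNat

theorem IntVFunctor.ext_injective (X Y : IntVCat V) :
    Function.Injective (fun F : IntVFunctor X Y => IntVFunctor.ext.{w} F) := fun F G h => by
  have happ (I : E) : IntVFunctor.fibre.{w} F I = G.fibre I :=
    congrArg (fun H : IndexedFunctor (IntVCat.ext.{w} X) (IntVCat.ext.{w} Y) => H.app I) h
  have hobj : F.obj = G.obj := by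
    have e := congrArg (fun P : VFunctor (IntVCat.fibre.{w} X _) (IntVCat.fibre.{w} Y _) =>
      (P.obj X.gen).down) (happ X.carrier)
    exact (Category.id_comp _).symm.trans (Eq.trans e (Category.id_comp _))
  refine ext_fam hobj fun {I} a b => ?_
  exact congrArg (fun P : VFunctor (IntVCat.fibre.{w} X I) (IntVCat.fibre.{w} Y I) =>
    FamHom.ar (P.map ⟨a⟩ ⟨b⟩)) (happ I)

/-! ### Transport of enriched functors along isomorphisms -/

namespace VCat

universe w₁ v' u' v'' u''

variable {M : Type u'} [Category.{v'} M] [MonoidalCategory M]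

/-- Associativity of composition with a global element in the middle. -/
theorem rc_whiskerRight_comp {A : VCat.{w₁} M} {x y : A.obj} (p : x ⟶ y) (t z : A.obj) :
    A.rc p z ▷ A.hom t x ≫ A.comp t x z = A.hom y z ◁ A.lc p t ≫ A.comp t y z := by
  simp only [rc, lc, comp_whiskerRight, MonoidalCategory.whiskerLeft_comp, Category.assoc, A.assoc]
  simp

open Functor.LaxMonoidal in
theorem bc_rc {N : Type u''} [Category.{v''} N] [MonoidalCategory N] (Φ : M ⥤ N)
    [Φ.LaxMonoidal] {A : VCat.{w₁} M} {x y : A.obj} (p : x ⟶ y) (z : A.obj) :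
    (A.bc Φ).rc (bcPoint Φ p) z = Φ.map (A.rc p z) := by
  simp only [VCat.rc, VCat.bcPoint, VCat.bc, MonoidalCategory.whiskerLeft_comp, Category.assoc,
    μ_natural_right_assoc, Φ.map_comp, right_unitality_inv_assoc]

end VCat

/-- Change of base of an enriched natural transformation. -/
def VNat.bc {M N : Type*} [Category M] [MonoidalCategory M] [Category N] [MonoidalCategory N]
    (Φ : M ⥤ N) [Φ.LaxMonoidal] {A B : VCat M} {P Q : VFunctor A B} (α : P ⟶ Q) :
    P.bc Φ ⟶ Q.bc Φ :=
  VNat.ofNat (F := P.bc Φ) (G := Q.bc Φ) (fun a => VCat.bcPoint Φ (α.app a)) fun a b =>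
    (congrArg (Φ.map (P.map a b) ≫ ·) (VCat.bc_lc Φ (α.app b) _)).trans <|
      ((Φ.map_comp _ _).symm.trans ((congrArg Φ.map (α.nat a b)).trans (Φ.map_comp _ _))).trans
        (congrArg (Φ.map (Q.map a b) ≫ ·) (VCat.bc_rc Φ (α.app a) _)).symm

namespace VFunctor

universe w₁ w₂ v' u'

variable {M : Type u'} [Category.{v'} M] [MonoidalCategory M] {A : VCat.{w₁} M} {B : VCat.{w₂} M}
  (P : VFunctor A B) {o : A.obj → B.obj} (θ : ∀ a, P.obj a ≅ o a)

/-- Transport of an enriched functor along a family of isomorphisms: the functor with the action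
`o` on objects, and the action of `P` on homs conjugated by `θ`. -/
def transport : VFunctor A B where
  obj := o
  map a b := P.map a b ≫ B.lc (θ b).hom _ ≫ B.rc (θ a).inv _
  map_id a := by
    rw [← Category.assoc, P.map_id]
    have h : (𝟙 (P.obj a) : P.obj a ⟶ P.obj a).el = B.idm (P.obj a) := rfl
    rw [← h, ← Category.assoc, ← VCat.comp_el, ← VCat.comp_el', Category.id_comp,
      Iso.inv_hom_id]
    rfl
  map_comp a b c := by
    -- In the middle, `θ b` and its inverse cancel.
    have h : (B.rc (θ b).inv (o c) ⊗ₘ B.lc (θ b).hom (o a)) ≫ B.comp _ (o b) (o c) =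
        B.comp (o a) (P.obj b) (o c) := by
      rw [MonoidalCategory.tensorHom_def', Category.assoc, VCat.rc_whiskerRight_comp,
        ← Category.assoc, ← MonoidalCategory.whiskerLeft_comp, ← VCat.lc_comp', Iso.hom_inv_id,
        VCat.lc_id, MonoidalCategory.whiskerLeft_id, Category.id_comp]
    rw [← Category.assoc, P.map_comp, Category.assoc, ← Category.assoc (B.comp _ _ _),
      VCat.lc_comp, Category.assoc, VCat.comp_rc, ← h, ← VCat.rc_lc (θ a).inv (θ b).hom,
      ← tensorHom_comp_tensorHom, ← tensorHom_comp_tensorHom, Category.assoc, Category.assoc,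
      MonoidalCategory.tensorHom_def (B.lc _ _), Category.assoc]

/-- Transport along isomorphisms yields an isomorphic functor. -/
def transportIso : P ≅ P.transport θ :=
  isoMk (G := P.transport θ) θ fun a b => by
    have h : (P.map a b ≫ B.lc (θ b).hom _ ≫ B.rc (θ a).inv _) ≫ B.rc (θ a).hom (o b) =
        P.map a b ≫ B.lc (θ b).hom _ := by
      rw [Category.assoc, Category.assoc, ← VCat.rc_comp', Iso.hom_inv_id, VCat.rc_id,
        Category.comp_id]
    exact h.symm

end VFunctor

/-! ### Local essential surjectivity -/

namespace IndexedFunctor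

/-- The diagram chase behind `isoC_genIso`: `h₁` is compatibility of an indexed functor with
composites, `h₂` naturality of its comparison isomorphism, `h₃` a coherence between identities. -/
theorem isoC_glue {C : Type*} [Category C] {x₀ x₁ x₂ x₃ x₄ x₅ x₆ : C} {e' : x₀ ⟶ x₁}
    {φ : x₁ ⟶ x₂} {c' : x₂ ⟶ x₃} {c : x₁ ⟶ x₄} {ψ : x₄ ⟶ x₅} {m : x₅ ⟶ x₃} {φ' : x₀ ⟶ x₆}
    {n : x₆ ⟶ x₅} {k : x₀ ⟶ x₄} (h₁ : c ≫ ψ ≫ m = φ ≫ c') (h₂ : k ≫ ψ = φ' ≫ n)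
    (h₃ : e' ≫ c = k) : φ' ≫ n ≫ m = (e' ≫ φ) ≫ c' := by
  rw [Category.assoc, ← h₁, reassoc_of% h₃, reassoc_of% h₂]

theorem inv_glue {C : Type*} [Category C] {x₀ x₁ x₂ x₃ : C} {e : x₀ ≅ x₁} {φ : x₀ ⟶ x₂}
    {m : x₂ ⟶ x₃} {m' : x₃ ⟶ x₂} {c : x₁ ⟶ x₃} (h₁ : φ ≫ m = e.hom ≫ c) (h₂ : m ≫ m' = 𝟙 x₂) :
    e.inv ≫ φ = c ≫ m' := by
  rw [Iso.inv_comp_eq, ← reassoc_of% h₁, h₂, Category.comp_id]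

variable {X Y : IntVCat V} (G : IndexedFunctor (IntVCat.ext.{w} X) (IntVCat.ext.{w} Y)) {I J : E}

/-- The value of an indexed functor between externalizations at the generic element. -/
def genObj : X.carrier ⟶ Y.carrier :=
  ULift.down (α := X.carrier ⟶ Y.carrier) ((G.app X.carrier).obj X.gen)

/-- The comparison of the value at `a` with the reindexing along `a` of the value at the generic
element. -/
def genIso (a : (IntVCat.fibre.{w} X I).obj) :
    (G.app I).obj a ≅ (ULift.up (a.down ≫ G.genObj) : (IntVCat.fibre.{w} Y I).obj) :=
  (G.app I).pmapIso (eqToIso (X.eq_fibreRe_gen a)) ≪≫ G.isoC a.down X.gen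

theorem fibreRe_genObj (f : I ⟶ J) (a : (IntVCat.fibre.{w} X J).obj) :
    (ULift.up (((X.fibreRe f).obj a).down ≫ G.genObj) : (IntVCat.fibre.{w} Y I).obj) =
      (Y.fibreRe f).obj (ULift.up (a.down ≫ G.genObj)) :=
  congrArg ULift.up (Category.assoc _ _ _)

/-- The comparison isomorphisms are stable under reindexing. -/
theorem isoC_genIso (f : I ⟶ J) (a : (IntVCat.fibre.{w} X J).obj) :
    (G.isoC f a).hom ≫ (Y.fibreRe f).bcMap (G.genIso a).hom =
      (G.genIso ((X.fibreRe f).obj a)).hom ≫ eqToHom (G.fibreRe_genObj f a) := by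
  have h₁ := G.iso_comp f a.down (f ≫ a.down) rfl X.gen
  have h₂ := G.isoC_nat f (eqToHom (X.eq_fibreRe_gen a))
  have h₃ : (G.app I).pmap (eqToHom (X.eq_fibreRe_gen ((X.fibreRe f).obj a))) ≫
      (G.app I).pmap ((IntVCat.ext.{w} X).compC f a.down (f ≫ a.down) rfl X.gen).hom =
      (G.app I).pmap ((X.fibreRe f).bcMap (eqToHom (X.eq_fibreRe_gen a))) :=
    ((G.app I).pmap_comp _ _).symm.trans <| congrArg (G.app I).pmap <|
      ((IsPtId.of_eq _).comp (X.extData_compC f a.down (f ≫ a.down) rfl X.gen)).eq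
        (X.fibreRe_pmap (IsPtId.of_eq (X.eq_fibreRe_gen a)))
  exact (congrArg ((G.isoC f a).hom ≫ ·) (VFunctor.bcMap_comp _ _ _)).trans
    (isoC_glue h₁ h₂ h₃)

/-- The functor on fibres isomorphic to `G`, which acts on objects by composition with the value
at the generic element. -/
def straighten (I : E) : VFunctor (IntVCat.fibre.{w} X I) (IntVCat.fibre.{w} Y I) :=
  (G.app I).transport fun a => G.genIso a

/-- On each fibre, `G` is isomorphic to its straightening. -/
def straightenIso (I : E) : G.app I ≅ G.straighten I :=
  (G.app I).transportIso fun a => G.genIso a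

/-- The straightened functors commute with reindexing up to identities. -/
def straightenRe (f : I ⟶ J) : (X.fibreRe f).comp (G.straighten I) ⟶
    ((G.straighten J).bc (V.toIntCat.reindex f)).comp (Y.fibreRe f) :=
  VFunctor.whiskerLeft (X.fibreRe f) (G.straightenIso I).inv ≫ (G.iso f).hom ≫
    VFunctor.whiskerRight (VNat.bc (V.toIntCat.reindex f) (G.straightenIso J).hom) (Y.fibreRe f)

/-- This is where the cocycle condition for the comparison isomorphisms of `G` enters. -/
theorem straightenRe_app (f : I ⟶ J) (a : (IntVCat.fibre.{w} X J).obj) :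
    IsPtId ((G.straightenRe f).app a) :=
  ⟨G.fibreRe_genObj f a, (Iso.inv_comp_eq (G.genIso _)).mpr (G.isoC_genIso f a)⟩

/-- The action of the straightened functors on homs is stable under reindexing, hence comes from a
single arrow of `E`. -/
theorem straighten_map_ar (f : I ⟶ J) (a b : (IntVCat.fibre.{w} X J).obj) :
    FamHom.ar ((G.straighten I).map ((X.fibreRe f).obj a) ((X.fibreRe f).obj b)) =
      f ≫ FamHom.ar ((G.straighten J).map a b) := by
  have h := congrArg FamHom.ar ((G.straightenRe f).nat a b)
  refine ((X.fibreRe_map f a b).comp_ar _).symm.trans ?_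
  refine (((G.straightenRe_app f b).lc _).ar_comp _).symm.trans (h.trans ?_)
  refine (((G.straightenRe_app f a).rc _).ar_comp _).trans ?_
  exact (Y.fibreRe_map f _ _).ar_comp _

/-- The internal functor whose externalization is isomorphic to `G`. -/
def toInt : IntVFunctor X Y :=
  IntVFunctor.ofFam G.genObj (fun {I} a b => (G.straighten I).map (ULift.up a) (ULift.up b))
    (fun _ _ r a b => G.straighten_map_ar r (ULift.up a) (ULift.up b))
    (fun I a => (G.straighten I).map_id (ULift.up a))
    (fun I a b c => (G.straighten I).map_comp (ULift.up a) (ULift.up b) (ULift.up c))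

theorem toInt_map (a b : (IntVCat.fibre.{w} X I).obj) :
    (G.toInt.fibre I).map a b = (G.straighten I).map a b :=
  fam_hom_ext (IntVFunctor.ofFam_mapFam_ar a.down b.down)

/-- The externalization of the internal functor associated with `G` is isomorphic to `G`. -/
def extToIntIso : IntVFunctor.ext.{w} G.toInt ≅ G where
  hom := IndexedNat.mk (F := IntVFunctor.ext.{w} G.toInt) (G := G)
    (fun I => VNat.ofNat (F := G.toInt.fibre I) (G := G.app I) (fun a => (G.genIso a).inv)
      fun a b => (congrArg (· ≫ _) (G.toInt_map a b)).trans ((G.straightenIso I).inv.nat a b))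
    fun {I J} f a => by
      have h : (Y.fibreRe f).bcMap (G.genIso a).hom ≫ (Y.fibreRe f).bcMap (G.genIso a).inv =
          𝟙 _ :=
        (VFunctor.bcMap_comp _ _ _).symm.trans <|
          (congrArg (Y.fibreRe f).bcMap (G.genIso a).hom_inv_id).trans (VFunctor.bcMap_id _ _)
      exact inv_glue (e := G.genIso ((X.fibreRe f).obj a)) (G.isoC_genIso f a) h
  inv := IndexedNat.mk (F := G) (G := IntVFunctor.ext.{w} G.toInt)
    (fun I => VNat.ofNat (F := G.app I) (G := G.toInt.fibre I) (fun a => (G.genIso a).hom)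
      fun a b => ((G.straightenIso I).hom.nat a b).trans
        (congrArg (· ≫ _) (G.toInt_map a b)).symm)
    fun f a => (G.isoC_genIso f a).symm
  hom_inv_id := nat_ext fun I a => (G.genIso a).inv_hom_id
  inv_hom_id := nat_ext fun I a => (G.genIso a).hom_inv_id

end IndexedFunctor

end Externalization

end InternalEnrichment

theorem mainTheorem2 {E : Type u} [Category.{v} E] [CartesianMonoidalCategory E]
    [HasFiniteLimits E] (V : InternalEnrichment.IntMonCat E) :
    ∃ Φ : StrictPseudofunctor (InternalEnrichment.IntVCat V)
        (InternalEnrichment.IndexedCat.{max v w} V.ext),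
      Φ.toPrelaxFunctorStruct = InternalEnrichment.externalization.{w} V ∧
      (∀ X Y : InternalEnrichment.IntVCat V, (Φ.mapFunctor X Y).IsEquivalence) ∧
      (∀ X Y : InternalEnrichment.IntVCat V,
        Function.Injective fun F : X ⟶ Y => Φ.map F) := by
  refine ⟨InternalEnrichment.extPseudofunctor.{w} V, rfl, fun X Y => ?_,
    fun X Y => InternalEnrichment.IntVFunctor.ext_injective.{w} X Y⟩
  exact
    { faithful := ⟨fun {F G} _ _ h =>
        InternalEnrichment.IntVNat.ext_injective.{w} (F := F) (G := G) h⟩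
      full := ⟨fun {F G} N =>
        ⟨InternalEnrichment.IntVNat.ofExt.{w} (F := F) (G := G) N,
          InternalEnrichment.IntVNat.ext_ofExt N⟩⟩
      essSurj := ⟨fun G => ⟨InternalEnrichment.IndexedFunctor.toInt.{w} G,
        ⟨InternalEnrichment.IndexedFunctor.extToIntIso.{w} G⟩⟩⟩ }
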